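/- Let $N\ge 1$, let $\mathfrak{su}(N)$ be the Lie algebra of $\mathrm{SU}(N)$ with the invariant form $\mathcal B(X,Y)=-\operatorname{tr}(XY)$, and let $t$ be a generator of $\pi_1(S^1)\cong\mathbb Z$. A representation $\rho\colon\pi_1(S^1)\to \mathrm{SU}(N)$ is regular if the centralizer of $\rho(t)$ has minimal dimension among the centralizers of elements of $\mathrm{SU}(N)$ (equivalently, if the eigenvalues of $\rho(t)$ are distinct). Let $\mathcal R^{reg}(S^1,\mathrm{SU}(N))$ be the space of conjugacy classes of regular representations, with the quotient topology. Its tangent space at $[\rho]$ is identified with $H^1(S^1;\operatorname{Ad}\rho)$, of real dimension $r=N-1$: the velocity at $s=0$ of a curve $[\rho_s]$ with $\rho_0=\rho$ is the class of the crossed morphism $\gamma\mapsto \frac{d}{ds}\big|_{s=0}\rho_s(\gamma)\,\rho(\gamma)^{-1}$. For bases $\mathbf u$ of $H^0(S^1;\operatorname{Ad}\rho)$ and $\mathbf v$ of $H^1(S^1;\operatorname{Ad}\rho)$, let $\operatorname{TOR}(S^1,\operatorname{Ad}\rho,\mathfrak o,\mathbf u,\mathbf v)$ be Turaev's sign-determined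 Reidemeister torsion, computed from the cochain complex $C^*(K;\operatorname{Ad}\rho)$ of a cell decomposition $K$ of $S^1$, with $\mathfrak o$ the cohomology orientation induced by an orientation of $S^1$. Let $\langle\wedge\mathbf v,\wedge\mathbf u\rangle=\det(\langle v_i,u_j\rangle)_{i,j}$, where $\langle\cdot,\cdot\rangle\colon H^1(S^1;\operatorname{Ad}\rho)\times H^0(S^1;\operatorname{Ad}\rho)\to H^1(S^1;\mathbb R)\cong\mathbb R$ is the duality pairing defined by $\mathcal B$ and the same orientation of $S^1$. The peripheral form $\nu\colon\bigwedge^{r}H^1(S^1;\operatorname{Ad}\rho)\to\mathbb R$ is defined, up to sign, by $$\nu(\wedge\mathbf v)=\pm\sqrt{\operatorname{TOR}(S^1,\operatorname{Ad}\rho,\mathfrak o,\mathbf u,\mathbf v)\,\langle\wedge\mathbf v,\wedge\mathbf u\rangle}$$ for all $\mathbf u$, $\mathbf v$; the right-hand side depends neither on $\mathbf u$ nor on the orientation. Proposition. Every point of $\mathcal R^{reg}(S^1,\mathrm{SU}(N))$ has an open neighbourhood $U$ with continuous functions $\theta_1,\dots,\theta_N\colon U\to\mathbb R$ such that, for all $[\rho]\in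 U$, the eigenvalues of $\rho(t)$ are $e^{i\theta_1([\rho])},\dots,e^{i\theta_N([\rho])}$. For every open $U$ and all such functions, each $\theta_j$ is differentiable on $U$, and at every point of $U$ the peripheral form exists, is unique up to sign, and is $$\nu=\pm\,2^{N(N-1)/2}\,\sqrt N\,\prod_{1\le i<j\le N}\sin\Big(\frac{\theta_i-\theta_j}{2}\Big)\;d\theta_1\wedge\cdots\wedge d\theta_{N-1}.$$ -/

import Mathlib

namespace PeripheralForm

/-! ### The circle and twisted cohomology -/

/-- The fundamental group of the circle, infinite cyclic. -/
abbrev CircleGroup : Type := Multiplicative ℤ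

/-- The generator `t` of the fundamental group of the circle. -/
def gen : CircleGroup := Multiplicative.ofAdd 1

section Cohomology

variable {V : Type*} [AddCommGroup V] [Module ℝ V]

/-- The cochains `Hom_π(C_i(K̃; ℤ), V)`, for `K` the cell decomposition of the circle with one
vertex and one edge, and `i = 0` or `i = 1`. The universal cover is the line, with vertices
`n ∈ ℤ` and edges `[n, n + 1]` (oriented from `n` to `n + 1`), on which `t ^ m` acts as translation
by `m`. Vertices and edges are both indexed by `ℤ`, so `C⁰` and `C¹` are both the space of
equivariant functions `ℤ → V`. -/
def Cochain (φ : Representation ℝ CircleGroup V) : Submodule ℝ (ℤ → V) where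
  carrier := {f | ∀ m n : ℤ, f (m + n) = φ (Multiplicative.ofAdd m) (f n)}
  add_mem' := by
    intro f g hf hg m n
    simp only [Pi.add_apply, hf m n, hg m n, map_add]
  zero_mem' := by
    intro m n
    simp
  smul_mem' := by
    intro c f hf m n
    simp only [Pi.smul_apply, hf m n, map_smul]

/-- A cochain is determined by its value on the preferred lifted cell (the vertex `0`, resp. the
edge `[0, 1]`), which is arbitrary. -/
def evalEquiv (φ : Representation ℝ CircleGroup V) : Cochain φ ≃ₗ[ℝ] V where
  toFun f := f.1 0
  map_add' _ _ := rfl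
  map_smul' _ _ := rfl
  invFun x := ⟨fun n => φ (Multiplicative.ofAdd n) x, by
    intro m n
    simp only [ofAdd_add, map_mul, Module.End.mul_apply]⟩
  left_inv f := by
    apply Subtype.ext
    funext n
    have h := f.2 n 0
    rw [add_zero] at h
    exact h.symm
  right_inv x := by
    show φ (Multiplicative.ofAdd 0) x = x
    rw [ofAdd_zero, map_one, Module.End.one_apply]

/-- The coboundary `C⁰ → C¹`: the value on the edge `[n, n + 1]` is `f (n + 1) - f n`. -/
def coboundary (φ : Representation ℝ CircleGroup V) : Cochain φ →ₗ[ℝ] Cochain φ where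
  toFun f := ⟨fun n => f.1 (n + 1) - f.1 n, by
    intro m n
    have h1 := f.2 m (n + 1)
    have h2 := f.2 m n
    show f.1 (m + n + 1) - f.1 (m + n) = φ (Multiplicative.ofAdd m) (f.1 (n + 1) - f.1 n)
    rw [map_sub, ← h1, ← h2, add_assoc]⟩
  map_add' f g := by
    apply Subtype.ext
    funext n
    show (f.1 (n + 1) + g.1 (n + 1)) - (f.1 n + g.1 n) =
      (f.1 (n + 1) - f.1 n) + (g.1 (n + 1) - g.1 n)
    abel
  map_smul' c f := by
    apply Subtype.ext
    funext n
    show c • f.1 (n + 1) - c • f.1 n = c • (f.1 (n + 1) - f.1 n)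
    rw [smul_sub]

/-- `H⁰(S¹; φ)`. -/
abbrev H0 (φ : Representation ℝ CircleGroup V) : Type _ := LinearMap.ker (coboundary φ)

/-- `H¹(S¹; φ)`. -/
abbrev H1 (φ : Representation ℝ CircleGroup V) : Type _ :=
  Cochain φ ⧸ LinearMap.range (coboundary φ)

/-- The class in `H¹(S¹; φ)` of the 1-cochain with value `x` on the edge `[0, 1]`, that is, of the
crossed morphism `d` on the fundamental group with `d t = x`. -/
def classOf (φ : Representation ℝ CircleGroup V) : V →ₗ[ℝ] H1 φ :=
  (LinearMap.range (coboundary φ)).mkQ ∘ₗ (evalEquiv φ).symm.toLinearMap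

/-! ### Sign-refined torsion of the circle -/

/-- The geometric basis `(ẽ)* ⊗ m_k` of the cochains (in degree `0` and in degree `1`). -/
noncomputable def geomBasis (φ : Representation ℝ CircleGroup V) {ι : Type*}
    (m : Module.Basis ι ℝ V) : Module.Basis ι ℝ (Cochain φ) :=
  m.map (evalEquiv φ).symm

/-- The torsion `[ṽ ⊔ b : c¹] / [b̃ ⊔ ũ : c⁰]`, where `b = δ b̃`, and `c⁰`, `c¹` are the geometric
bases attached to the basis `m` of `V`. -/
noncomputable def tor (φ : Representation ℝ CircleGroup V) {k r : ℕ}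
    (m : Module.Basis (Fin (k + r)) ℝ V) (bt : Fin k → Cochain φ) (ut vt : Fin r → Cochain φ) : ℝ :=
  ((geomBasis φ m).reindex (finCongr (Nat.add_comm k r))).det
      (Fin.append vt (fun i => coboundary φ (bt i))) /
    (geomBasis φ m).det (Fin.append bt ut)

/-- Turaev's exponent `α₀ β₀ + α₁ β₁`, with `α_i`, `β_i` the partial sums of the dimensions of the
cochain spaces and of the cohomology spaces. -/
noncomputable def turaevExponent (φ : Representation ℝ CircleGroup V) : ℕ :=
  Module.finrank ℝ (Cochain φ) * Module.finrank ℝ (H0 φ) +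
    (Module.finrank ℝ (Cochain φ) + Module.finrank ℝ (Cochain φ)) *
      (Module.finrank ℝ (H0 φ) + Module.finrank ℝ (H1 φ))

/-- The torsion with Turaev's sign correction. -/
noncomputable def Tor (φ : Representation ℝ CircleGroup V) {k r : ℕ}
    (m : Module.Basis (Fin (k + r)) ℝ V) (bt : Fin k → Cochain φ) (ut vt : Fin r → Cochain φ) : ℝ :=
  (-1) ^ turaevExponent φ * tor φ m bt ut vt

/-- The trivial one-dimensional real representation. -/
def trivialRep : Representation ℝ CircleGroup ℝ := 1

/-- The corrected torsion `Tor(S¹, 1, h⁰, h¹)` of the trivial representation on `ℝ`, for the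
cohomology orientation that the orientation `ε` of the circle induces: `h⁰` is the class of the
constant cochain `1`, and `h¹` is the class that takes the value `1` on the fundamental class. Here
`ε = 1` if the edge is positively oriented, and `ε = -1` otherwise. -/
noncomputable def trivialTor (ε : ℤˣ) : ℝ :=
  Tor trivialRep (k := 0) (r := 1) ((Module.Basis.singleton (Fin 1) ℝ).reindex (finCongr (Nat.zero_add 1).symm)) Fin.elim0
    (fun _ => (evalEquiv trivialRep).symm 1)
    (fun _ => (evalEquiv trivialRep).symm ((ε : ℤ) : ℝ))

/-- The sign-determined torsion `TOR(S¹, φ, 𝔬, u, v)`, where `𝔬` is the cohomology orientation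
induced by the orientation `ε` of the circle, computed from a basis `m` of `V`, lifts `bt` of a
basis of the coboundaries, and representatives `ut`, `vt` of the bases `u`, `v` of the cohomology
(see `IsTorsionData`). -/
noncomputable def TOR (φ : Representation ℝ CircleGroup V) (ε : ℤˣ) {k r : ℕ}
    (m : Module.Basis (Fin (k + r)) ℝ V) (bt : Fin k → Cochain φ) (ut vt : Fin r → Cochain φ) : ℝ :=
  Tor φ m bt ut vt * Real.sign (trivialTor ε) ^ Module.finrank ℝ V

/-- The choices in the computation of the torsion are admissible: `δ ∘ bt` is a basis of the space
of coboundaries, and `ut`, `vt` represent the bases `u` of `H⁰` and `v` of `H¹`. -/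
structure IsTorsionData (φ : Representation ℝ CircleGroup V) {k r : ℕ}
    (u : Module.Basis (Fin r) ℝ (H0 φ)) (v : Module.Basis (Fin r) ℝ (H1 φ))
    (bt : Fin k → Cochain φ) (ut vt : Fin r → Cochain φ) : Prop where
  linearIndependent : LinearIndependent ℝ (fun i => coboundary φ (bt i))
  span_eq : Submodule.span ℝ (Set.range fun i => coboundary φ (bt i)) =
    LinearMap.range (coboundary φ)
  repr_u : ∀ i, ut i = (u i : Cochain φ)
  repr_v : ∀ i, (LinearMap.range (coboundary φ)).mkQ (vt i) = v i

/-! ### Duality pairing and peripheral form -/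

/-- The duality pairing `H¹(S¹; φ) × H⁰(S¹; φ) → H¹(S¹; ℝ) ≅ ℝ` defined by the invariant bilinear
form `B` and by evaluation on the fundamental class of the circle with the orientation `ε`. -/
def pairing (φ : Representation ℝ CircleGroup V) (B : LinearMap.BilinForm ℝ V)
    (hB : ∀ γ x y, B (φ γ x) (φ γ y) = B x y) (ε : ℤˣ) : H1 φ →ₗ[ℝ] H0 φ →ₗ[ℝ] ℝ :=
  (LinearMap.range (coboundary φ)).liftQ
    (((ε : ℤ) : ℝ) • B.compl₁₂ (evalEquiv φ).toLinearMap
      ((evalEquiv φ).toLinearMap ∘ₗ (LinearMap.ker (coboundary φ)).subtype))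
    (by
      rintro _ ⟨w, rfl⟩
      rw [LinearMap.mem_ker]
      ext u
      have hu : u.1.1 (0 + 1) - u.1.1 0 = 0 :=
        congrFun (congrArg Subtype.val (LinearMap.mem_ker.1 u.2)) 0
      have hw1 : w.1 (0 + 1) = φ (Multiplicative.ofAdd 1) (w.1 0) := by
        rw [add_comm]
        exact w.2 1 0
      have hu1 : u.1.1 (0 + 1) = φ (Multiplicative.ofAdd 1) (u.1.1 0) := by
        rw [add_comm]
        exact u.1.2 1 0
      have key : B (w.1 (0 + 1) - w.1 0) (u.1.1 0) = 0 := by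
        rw [map_sub, LinearMap.sub_apply]
        have h2 : u.1.1 0 = u.1.1 (0 + 1) := (sub_eq_zero.1 hu).symm
        have h3 : B (w.1 (0 + 1)) (u.1.1 0) = B (w.1 0) (u.1.1 0) := by
          conv_lhs => rw [h2]
          rw [hw1, hu1, hB]
        rw [h3, sub_self]
      show ((ε : ℤ) : ℝ) • B (w.1 (0 + 1) - w.1 0) (u.1.1 0) = 0
      rw [key, smul_zero])

/-- `ν : ⋀^r H¹(S¹; φ) → ℝ` is the peripheral form (with either choice of the sign):
`ν (∧ v) = ± √(TOR(S¹, φ, 𝔬, u, v) ⟨∧ v, ∧ u⟩)` for every basis `u` of `H⁰` and `v` of `H¹`, the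
torsion being computed from any admissible choices, for either orientation of the circle. -/
def IsPeripheralForm (φ : Representation ℝ CircleGroup V) (B : LinearMap.BilinForm ℝ V)
    (hB : ∀ γ x y, B (φ γ x) (φ γ y) = B x y) {r : ℕ} (ν : H1 φ [⋀^Fin r]→ₗ[ℝ] ℝ) : Prop :=
  ∀ (ε : ℤˣ) (u : Module.Basis (Fin r) ℝ (H0 φ)) (v : Module.Basis (Fin r) ℝ (H1 φ))
    (k : ℕ) (m : Module.Basis (Fin (k + r)) ℝ V) (bt : Fin k → Cochain φ)
    (ut vt : Fin r → Cochain φ), IsTorsionData φ u v bt ut vt →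
      ν v ^ 2 = TOR φ ε m bt ut vt * (Matrix.of fun i j => pairing φ B hB ε (v i) (u j)).det

/-- The exterior product of `r` linear forms. -/
noncomputable def wedge {r : ℕ} (ω : Fin r → Module.Dual ℝ V) : V [⋀^Fin r]→ₗ[ℝ] ℝ :=
  Matrix.detRowAlternating.compLinearMap (LinearMap.pi ω)

end Cohomology

/-! ### The group `SU(N)` -/

/-- The group `SU(N)`. -/
abbrev SU (N : ℕ) : Type := Matrix.specialUnitaryGroup (Fin N) ℂ

/-- The real Lie algebra `su(N)` of traceless skew-Hermitian matrices. -/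
def su (N : ℕ) : Submodule ℝ (Matrix (Fin N) (Fin N) ℂ) where
  carrier := {X | X.conjTranspose = -X ∧ X.trace = 0}
  add_mem' := by
    rintro X Y ⟨hX, hX'⟩ ⟨hY, hY'⟩
    exact ⟨by rw [Matrix.conjTranspose_add, hX, hY, neg_add],
      by rw [Matrix.trace_add, hX', hY', add_zero]⟩
  zero_mem' := ⟨by simp, by simp⟩
  smul_mem' := by
    rintro c X ⟨hX, hX'⟩
    exact ⟨by rw [Matrix.conjTranspose_smul, hX, star_trivial, smul_neg],
      by rw [Matrix.trace_smul, hX', smul_zero]⟩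

theorem SU.star_mul_self {N : ℕ} (g : SU N) :
    star (g : Matrix (Fin N) (Fin N) ℂ) * (g : Matrix (Fin N) (Fin N) ℂ) = 1 :=
  Matrix.mem_unitaryGroup_iff'.1 (Matrix.mem_specialUnitaryGroup_iff.1 g.2).1

/-- The adjoint representation `Ad_g X = g X g⁻¹` of `SU(N)` on `su(N)`. -/
noncomputable def Ad (N : ℕ) : Representation ℝ (SU N) (su N) where
  toFun g :=
    { toFun := fun X => ⟨(g : Matrix (Fin N) (Fin N) ℂ) * X.1 *
          star (g : Matrix (Fin N) (Fin N) ℂ), by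
        refine ⟨?_, ?_⟩
        · rw [Matrix.star_eq_conjTranspose, Matrix.conjTranspose_mul, Matrix.conjTranspose_mul,
            Matrix.conjTranspose_conjTranspose, X.2.1, Matrix.neg_mul, Matrix.mul_neg,
            Matrix.mul_assoc]
        · rw [Matrix.trace_mul_comm, ← Matrix.mul_assoc, SU.star_mul_self, Matrix.one_mul, X.2.2]⟩
      map_add' := fun X Y => by
        apply Subtype.ext
        simp [Matrix.mul_add, Matrix.add_mul]
      map_smul' := fun c X => by
        apply Subtype.ext
        simp }
  map_one' := by
    ext1 X
    apply Subtype.ext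
    simp
  map_mul' g h := by
    ext1 X
    apply Subtype.ext
    simp [Matrix.mul_assoc]

/-- The invariant form `B(X, Y) = -tr(X Y)` on `su(N)`, where it takes real values. -/
noncomputable def traceForm (N : ℕ) : LinearMap.BilinForm ℝ (su N) :=
  LinearMap.mk₂ ℝ (fun X Y => -(Matrix.trace (X.1 * Y.1)).re)
    (by
      intro X X' Y
      simp [Matrix.add_mul]
      ring)
    (by
      intro c X Y
      simp)
    (by
      intro X Y Y'
      simp [Matrix.mul_add]
      ring)
    (by
      intro c X Y
      simp)

theorem traceForm_Ad {N : ℕ} (g : SU N) (X Y : su N) :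
    traceForm N (Ad N g X) (Ad N g Y) = traceForm N X Y := by
  have h : ((g : Matrix (Fin N) (Fin N) ℂ) * X.1 * star (g : Matrix (Fin N) (Fin N) ℂ)) *
      ((g : Matrix (Fin N) (Fin N) ℂ) * Y.1 * star (g : Matrix (Fin N) (Fin N) ℂ)) =
      (g : Matrix (Fin N) (Fin N) ℂ) * (X.1 * Y.1) * star (g : Matrix (Fin N) (Fin N) ℂ) := by
    calc _ = (g : Matrix (Fin N) (Fin N) ℂ) * X.1 * (star (g : Matrix (Fin N) (Fin N) ℂ) *
          (g : Matrix (Fin N) (Fin N) ℂ)) * Y.1 * star (g : Matrix (Fin N) (Fin N) ℂ) := by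
            simp only [Matrix.mul_assoc]
      _ = _ := by rw [SU.star_mul_self]; simp only [Matrix.mul_assoc, Matrix.one_mul]
  show -(Matrix.trace (((g : Matrix (Fin N) (Fin N) ℂ) * X.1 *
      star (g : Matrix (Fin N) (Fin N) ℂ)) * ((g : Matrix (Fin N) (Fin N) ℂ) * Y.1 *
      star (g : Matrix (Fin N) (Fin N) ℂ)))).re = -(Matrix.trace (X.1 * Y.1)).re
  rw [h, Matrix.trace_mul_comm, ← Matrix.mul_assoc, SU.star_mul_self, Matrix.one_mul]

/-- The dimension of the centralizer of `g` in `SU(N)`, that is, of its Lie algebra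
`{X | Ad_g X = X}`. -/
noncomputable def centralizerDim {N : ℕ} (g : SU N) : ℕ :=
  Module.finrank ℝ (LinearMap.ker (Ad N g - 1))

/-- `g` is regular if its centralizer has minimal dimension among centralizers of elements. -/
def IsRegular {N : ℕ} (g : SU N) : Prop := ∀ h : SU N, centralizerDim g ≤ centralizerDim h

/-! ### Regular representations of the circle group -/

/-- The regular representations of the fundamental group of the circle in `SU(N)`. -/
abbrev RegRep (N : ℕ) : Type := {ρ : CircleGroup →* SU N // IsRegular (ρ gen)}

/-- The topology on the space of representations: the identification with the image of the
generator is a homeomorphism onto its image. -/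
noncomputable instance regRepTopology (N : ℕ) : TopologicalSpace (RegRep N) :=
  TopologicalSpace.induced (fun ρ => ρ.1 gen) inferInstance

/-- Conjugacy of representations. -/
instance conjSetoid (N : ℕ) : Setoid (RegRep N) where
  r ρ ρ' := ∃ g : SU N, ∀ γ, ρ'.1 γ = g * ρ.1 γ * g⁻¹
  iseqv :=
    { refl := fun ρ => ⟨1, fun γ => by simp⟩
      symm := by
        rintro ρ ρ' ⟨g, hg⟩
        exact ⟨g⁻¹, fun γ => by rw [hg γ]; group⟩
      trans := by
        rintro ρ ρ' ρ'' ⟨g, hg⟩ ⟨h, hh⟩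
        exact ⟨h * g, fun γ => by rw [hh γ, hg γ]; group⟩ }

/-- The space of conjugacy classes of regular representations, with the quotient topology. -/
abbrev RegClasses (N : ℕ) : Type := Quotient (conjSetoid N)

/-- The representation `Ad ρ` of the circle group on `su(N)`. -/
noncomputable def AdRep {N : ℕ} (ρ : RegRep N) : Representation ℝ CircleGroup (su N) :=
  (Ad N).comp ρ.1

theorem traceForm_AdRep {N : ℕ} (ρ : RegRep N) (γ : CircleGroup) (X Y : su N) :
    traceForm N (AdRep ρ γ X) (AdRep ρ γ Y) = traceForm N X Y :=
  traceForm_Ad (ρ.1 γ) X Y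

/-- `L` is the differential at `[ρ]` of the function `f` on the space of conjugacy classes, under
the identification of the tangent space at `[ρ]` with `H¹(S¹; Ad ρ)`: the velocity of a curve
`[c s]` with `c 0 = ρ` is the class of the crossed morphism `t ↦ X = (d/ds) c s t · (ρ t)⁻¹`. -/
def HasDifferentialAt {N : ℕ} (f : RegClasses N → ℝ) (ρ : RegRep N)
    (L : Module.Dual ℝ (H1 (AdRep ρ))) : Prop :=
  ∀ (c : ℝ → RegRep N) (X : su N), c 0 = ρ →
    (∀ i j, HasDerivAt (fun s => ((c s).1 gen : Matrix (Fin N) (Fin N) ℂ) i j)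
      ((X.1 * (ρ.1 gen : Matrix (Fin N) (Fin N) ℂ)) i j) 0) →
    HasDerivAt (fun s => f ⟦c s⟧) (L (classOf (AdRep ρ) X)) 0

/-- The functions `θ_1, …, θ_N` are a continuous choice of the angles of the eigenvalues on the
open set `U`: at a class `[ρ]` in `U` the eigenvalues of `ρ t`, with multiplicity, are the
`exp(i θ_j)`. -/
structure IsAngleSystem {N : ℕ} (U : Set (RegClasses N)) (θ : Fin N → RegClasses N → ℝ) :
    Prop where
  isOpen : IsOpen U
  continuousOn : ∀ j, ContinuousOn (θ j) U
  charpoly_eq : ∀ ρ : RegRep N, ⟦ρ⟧ ∈ U →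
    (ρ.1 gen : Matrix (Fin N) (Fin N) ℂ).charpoly =
      ∏ j, (Polynomial.X - Polynomial.C (Complex.exp (Complex.I * (θ j ⟦ρ⟧ : ℂ))))

end PeripheralForm

open PeripheralForm

/-!
Write `N = n + 1`. A regular element `g = ρ t` is diagonalised by a unitary matrix `P`, with
distinct eigenvalues `λ_j = exp(i θ_j)` (`IsRegular.exists_diagonalization`). On `su(N)` take as
coordinates the imaginary parts of the first `n` diagonal entries of `P⁻¹ X P` and its entries above
the diagonal (`frameCoords`). In these coordinates `Ad g - 1` is `0 × T'`, where `T'` multiplies the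
`(i, j)` entry by `λ_i λ̄_j - 1 ≠ 0` (`frameCoords_Ad`). Hence `H⁰` is the Lie algebra of the
maximal torus, and `H¹` is identified with it by forgetting the off-diagonal part.

The torsion is a quotient of two determinants that become block triangular in these coordinates.
Together with the pairing it gives `det T' * det G` times the square of the coordinate volume form
on `H¹`, where `G` is the Gram matrix of the trace form on the torus (`TOR_mul_det_pairing`); all
signs cancel because the number `N (N - 1)` of off-diagonal real coordinates is even. Here
`det G = N`, as `G` is the identity plus the all-ones matrix, and
`det T' = ∏ |λ_i λ̄_j - 1|² = ∏ 4 sin² ((θ_i - θ_j) / 2)` over `i < j`. Since `⋀^n H¹` is a line,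
knowing the square of `ν` on a basis determines `ν` up to sign (`isPeripheralForm_iff`).

It remains to see that the coordinate volume form is `dθ_1 ∧ ⋯ ∧ dθ_n`, that is, that
`dθ_j (X) = Im (P⁻¹ X P)_jj`. Along a curve with velocity `X`, the characteristic polynomial
evaluated at `λ_j` is a differentiable function, and it is `λ_j - μ_j(s)` times a continuous
nonvanishing product, where `μ_j(s)` is the moving eigenvalue; so `μ_j`, and with it `θ_j`, is
differentiable with the asserted derivative (`IsAngleSystem.hasDerivAt`). Conversely this determines
the differential, because every class in `H¹` is the velocity of a curve that rotates the
eigenvalues (`exists_curve_diagonal`).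

Angles exist locally (`exists_isAngleSystem`) because a monic polynomial that is small at a point
has a root nearby, so that simple eigenvalues move continuously.
-/

namespace PeripheralForm

open Filter Topology

/-! ### Torsion of the circle in adapted coordinates -/

theorem coboundary_apply_zero {V : Type*} [AddCommGroup V] [Module ℝ V]
    (φ : Representation ℝ CircleGroup V) (f : Cochain φ) :
    evalEquiv φ (coboundary φ f) = φ gen (evalEquiv φ f) - evalEquiv φ f := by
  have h := f.2 1 0
  rw [add_comm] at h
  show f.1 (0 + 1) - f.1 0 = φ (Multiplicative.ofAdd 1) (f.1 0) - f.1 0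
  rw [h]

theorem append_comp_finAddFlip {α : Type*} {k r : ℕ} (x : Fin k → α) (y : Fin r → α) :
    Fin.append y x ∘ finAddFlip = Fin.append x y := by
  funext i
  refine Fin.addCases (fun a => ?_) (fun a => ?_) i <;> simp

theorem val_finRotate_pow {n : ℕ} (l : ℕ) (i : Fin n) :
    (((finRotate n) ^ l) i : ℕ) = (i + l) % n := by
  cases n with
  | zero => exact i.elim0
  | succ n =>
    induction l with
    | zero => simp [Nat.mod_eq_of_lt i.2]
    | succ l ih =>
      rw [pow_succ', Equiv.Perm.mul_apply, finRotate_apply, Fin.val_add, ih]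
      simp [add_assoc]

/-- Exchanging a block of even length with another block is an even permutation, because its
inverse is an even power of a cyclic shift. -/
theorem sign_finAddFlip_trans_finCongr {k r : ℕ} (hk : Even k) :
    Equiv.Perm.sign ((finAddFlip (m := k) (n := r)).trans (finCongr (Nat.add_comm r k))) = 1 := by
  have h : (finRotate (k + r)) ^ k *
      (finAddFlip (m := k) (n := r)).trans (finCongr (Nat.add_comm r k)) = 1 := by
    ext i
    rw [Equiv.Perm.mul_apply, val_finRotate_pow]
    refine Fin.addCases (fun a => ?_) (fun a => ?_) i
    · have := a.2
      simp
      rw [show (a : ℕ) + r + k = a + (k + r) by ring, Nat.add_mod_right,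
        Nat.mod_eq_of_lt (by omega)]
    · have := a.2
      simp
      rw [Nat.mod_eq_of_lt (by omega), add_comm]
  have hu : ∀ u : ℤˣ, u ^ k = 1 := by
    obtain ⟨l, rfl⟩ := hk
    intro u
    rw [pow_add, Int.units_mul_self]
  have h2 := congrArg Equiv.Perm.sign h
  rwa [map_mul, map_pow, map_one, hu, one_mul] at h2

/-- Moving a block of even length past another block does not change the determinant, so the
order `[ṽ ⊔ b : c¹]` in the torsion may be reversed. -/
theorem det_append_comm {V : Type*} [AddCommGroup V] [Module ℝ V] {k r : ℕ} (hk : Even k)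
    (m : Module.Basis (Fin (k + r)) ℝ V) (x : Fin k → V) (y : Fin r → V) :
    (m.reindex (finCongr (Nat.add_comm k r))).det (Fin.append y x) = m.det (Fin.append x y) := by
  rw [Module.Basis.det_reindex, ← append_comp_finAddFlip x y]
  have := m.det.map_perm (Fin.append y x ∘ finAddFlip)
    ((finAddFlip (m := k) (n := r)).trans (finCongr (Nat.add_comm r k)))⁻¹
  rw [Equiv.Perm.sign_inv, sign_finAddFlip_trans_finCongr hk, one_smul] at this
  rw [← this]
  congr 1
  funext i
  simp [Equiv.Perm.inv_def]

/-- In the basis that `E` and a basis `w` of `W` provide, the determinant of two concatenated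
families is that of the block matrix of their `W`- and `ℝ^r`-components. -/
theorem det_append_prod {V W : Type*} [AddCommGroup V] [Module ℝ V] [AddCommGroup W] [Module ℝ W]
    {k r : ℕ} (w : Module.Basis (Fin k) ℝ W) (E : V ≃ₗ[ℝ] (Fin r → ℝ) × W)
    (x : Fin k → V) (y : Fin r → V) :
    ((((Pi.basisFun ℝ (Fin r)).prod w).map E.symm).reindex
      ((Equiv.sumComm _ _).trans finSumFinEquiv)).det (Fin.append x y) =
    (Matrix.fromBlocks (w.toMatrix fun i => (E (x i)).2) (w.toMatrix fun i => (E (y i)).2)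
      (Matrix.of fun i j => (E (x j)).1 i) (Matrix.of fun i j => (E (y j)).1 i)).det := by
  rw [Module.Basis.det_reindex, Module.Basis.det_apply,
    ← Matrix.det_reindex_self (Equiv.sumComm (Fin r) (Fin k))]
  congr 1
  ext (i | i) (j | j) <;> simp [Module.Basis.toMatrix_apply]

/-- The two determinants of the torsion, compared in coordinates `E` where the operator `T` is
`0 × T'` and the vectors `u` are invariant: both matrices are block triangular, and the
components of `b` in `W` contribute `det T'` to the quotient. -/
theorem tor_identity {V W : Type*} [AddCommGroup V] [Module ℝ V] [AddCommGroup W] [Module ℝ W]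
    [FiniteDimensional ℝ W]
    {k r : ℕ} (hk : Even k) (m : Module.Basis (Fin (k + r)) ℝ V) (E : V ≃ₗ[ℝ] (Fin r → ℝ) × W)
    (T : V →ₗ[ℝ] V) (T' : W →ₗ[ℝ] W) (hT : ∀ x, E (T x) = (0, T' (E x).2))
    (b : Fin k → V) (u v : Fin r → V) (hu : ∀ i, (E (u i)).2 = 0) :
    (m.reindex (finCongr (Nat.add_comm k r))).det (Fin.append v fun i => T (b i)) *
        (Matrix.of fun i j => (E (u j)).1 i).det =
      LinearMap.det T' * (Matrix.of fun i j => (E (v j)).1 i).det * m.det (Fin.append b u) := by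
  have hdim : Module.finrank ℝ W = k := by
    have h1 := E.finrank_eq
    rw [Module.finrank_prod, Module.finrank_eq_card_basis m] at h1
    simp at h1
    omega
  let w : Module.Basis (Fin k) ℝ W := Module.finBasisOfFinrankEq ℝ W hdim
  rw [det_append_comm hk, AlternatingMap.eq_smul_basis_det (((((Pi.basisFun ℝ (Fin r)).prod w).map
    E.symm).reindex ((Equiv.sumComm _ _).trans finSumFinEquiv))) m.det]
  simp only [AlternatingMap.smul_apply, det_append_prod]
  have h1 : (w.toMatrix fun i => (E (u i)).2) = 0 := by
    ext i j
    simp [Module.Basis.toMatrix_apply, hu]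
  have h2 : (Matrix.of fun i j => (E (T (b j))).1 i) = (0 : Matrix (Fin r) (Fin k) ℝ) := by
    ext i j
    simp [hT]
  have h3 : (w.toMatrix fun i => (E (T (b i))).2).det =
      LinearMap.det T' * (w.toMatrix fun i => (E (b i)).2).det := by
    simp only [hT]
    exact w.det_comp T' _
  rw [h1, h2, Matrix.det_fromBlocks_zero₂₁, Matrix.det_fromBlocks_zero₁₂, h3]
  simp only [smul_eq_mul]
  ring

theorem finrank_H0_trivialRep : Module.finrank ℝ (H0 trivialRep) = 1 := by
  have h : LinearMap.ker (coboundary trivialRep) = ⊤ := by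
    rw [eq_top_iff]
    rintro f -
    rw [LinearMap.mem_ker]
    apply (evalEquiv trivialRep).injective
    rw [coboundary_apply_zero, map_zero]
    exact sub_self _
  show Module.finrank ℝ (LinearMap.ker (coboundary trivialRep)) = 1
  rw [h, finrank_top, (evalEquiv trivialRep).finrank_eq, Module.finrank_self]

/-- The Turaev exponent of the trivial representation is odd, whence the minus sign. -/
theorem trivialTor_eq (ε : ℤˣ) : trivialTor ε = -((ε : ℤ) : ℝ) := by
  have h1 : Odd (turaevExponent trivialRep) := by
    rw [turaevExponent, finrank_H0_trivialRep, (evalEquiv trivialRep).finrank_eq]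
    simp only [Module.finrank_self]
    exact ⟨1 + Module.finrank ℝ (H1 trivialRep), by ring⟩
  rw [trivialTor, Tor, h1.neg_one_pow, tor]
  have e1 : (Fin.append (fun _ => (evalEquiv trivialRep).symm ((ε : ℤ) : ℝ))
      (fun i => coboundary trivialRep (Fin.elim0 i)) : Fin (1 + 0) → Cochain trivialRep) =
      fun _ => (evalEquiv trivialRep).symm ((ε : ℤ) : ℝ) := by
    funext i
    refine Fin.addCases (fun a => ?_) (fun a => a.elim0) i
    exact Fin.append_left _ _ a
  have e2 : (Fin.append Fin.elim0 (fun _ => (evalEquiv trivialRep).symm 1) :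
      Fin (0 + 1) → Cochain trivialRep) = fun _ => (evalEquiv trivialRep).symm 1 := by
    funext i
    refine Fin.addCases (fun a => a.elim0) (fun a => ?_) i
    simp
  rw [e1, e2, geomBasis]
  simp only [Module.Basis.det_apply]
  erw [Matrix.det_fin_one, Matrix.det_fin_one]
  simp [Module.Basis.toMatrix_apply]

theorem sign_trivialTor (ε : ℤˣ) : Real.sign (trivialTor ε) = -((ε : ℤ) : ℝ) := by
  rw [trivialTor_eq]
  rcases Int.units_eq_one_or ε with rfl | rfl <;> simp [Real.sign_of_neg]

theorem linearIndependent_coe_basis {ι M : Type*} [AddCommGroup M] [Module ℝ M]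
    {S : Submodule ℝ M} (u : Module.Basis ι ℝ S) : LinearIndependent ℝ fun i => (u i : M) :=
  u.linearIndependent.map' S.subtype S.ker_subtype

/-- The denominator of the torsion does not vanish: applying `δ` to a linear relation between the
`bt i` and the cocycles `ut i` kills the latter. -/
theorem det_append_ne_zero {V : Type*} [AddCommGroup V] [Module ℝ V]
    (φ : Representation ℝ CircleGroup V) {k r : ℕ} {u : Module.Basis (Fin r) ℝ (H0 φ)}
    {v : Module.Basis (Fin r) ℝ (H1 φ)} (m : Module.Basis (Fin (k + r)) ℝ V)
    {bt : Fin k → Cochain φ} {ut vt : Fin r → Cochain φ} (h : IsTorsionData φ u v bt ut vt) :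
    m.det (Fin.append (fun i => evalEquiv φ (bt i)) fun i => evalEquiv φ (ut i)) ≠ 0 := by
  have hli : LinearIndependent ℝ ut := by
    rw [show ut = fun i => (u i : Cochain φ) from funext h.repr_u]
    exact linearIndependent_coe_basis u
  have hut : ∀ i, coboundary φ (ut i) = 0 := fun i => by
    rw [h.repr_u]
    exact LinearMap.mem_ker.1 (u i).2
  have hind : LinearIndependent ℝ (Fin.append bt ut) := by
    rw [Fintype.linearIndependent_iff]
    intro g hg
    rw [Fin.sum_univ_add] at hg
    simp only [Fin.append_left, Fin.append_right] at hg
    have h1 : ∀ i, g (Fin.castAdd r i) = 0 := by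
      apply Fintype.linearIndependent_iff.1 h.linearIndependent fun i => g (Fin.castAdd r i)
      have h2 := congrArg (coboundary φ) hg
      simpa only [map_add, map_sum, map_smul, hut, smul_zero, Finset.sum_const_zero, add_zero,
        map_zero] using h2
    have h2 : ∀ i, g (Fin.natAdd k i) = 0 := by
      apply Fintype.linearIndependent_iff.1 hli fun i => g (Fin.natAdd k i)
      simpa only [h1, zero_smul, Finset.sum_const_zero, zero_add] using hg
    exact fun i => Fin.addCases h1 h2 i
  have hind2 := hind.map' (evalEquiv φ).toLinearMap (evalEquiv φ).ker
  have e : (evalEquiv φ).toLinearMap ∘ Fin.append bt ut =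
      Fin.append (fun i => evalEquiv φ (bt i)) fun i => evalEquiv φ (ut i) := by
    funext i
    refine Fin.addCases (fun a => ?_) (fun a => ?_) i <;> simp
  rw [e] at hind2
  refine (m.is_basis_iff_det.1 ⟨hind2, ?_⟩).ne_zero
  have := Module.Finite.of_basis m
  apply hind2.span_eq_top_of_card_eq_finrank'
  rw [Module.finrank_eq_card_basis m]

/-- The radicand in the definition of the peripheral form, in adapted coordinates `E`. The basis `u`
of `H⁰` enters the torsion and the pairing with inverse determinants and cancels. So do all the
signs, those of the orientation `ε` included, because `dim V - r = k` is even. -/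
theorem TOR_mul_det_pairing {V W : Type*} [AddCommGroup V] [Module ℝ V] [AddCommGroup W]
    [Module ℝ W] [FiniteDimensional ℝ W]
    (φ : Representation ℝ CircleGroup V) (B : LinearMap.BilinForm ℝ V)
    (hB : ∀ γ x y, B (φ γ x) (φ γ y) = B x y) {k r : ℕ} (hk : Even k)
    (E : V ≃ₗ[ℝ] (Fin r → ℝ) × W) (T' : W →ₗ[ℝ] W) (hT' : LinearMap.det T' ≠ 0)
    (hE : ∀ x, E (φ gen x - x) = (0, T' (E x).2)) (G : Matrix (Fin r) (Fin r) ℝ)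
    (hG : ∀ x y, (E y).2 = 0 → B x y = (E x).1 ⬝ᵥ (G.mulVec (E y).1))
    (ε : ℤˣ) (u : Module.Basis (Fin r) ℝ (H0 φ)) (v : Module.Basis (Fin r) ℝ (H1 φ))
    (m : Module.Basis (Fin (k + r)) ℝ V) (bt : Fin k → Cochain φ)
    (ut vt : Fin r → Cochain φ) (h : IsTorsionData φ u v bt ut vt) :
    TOR φ ε m bt ut vt * (Matrix.of fun i j => pairing φ B hB ε (v i) (u j)).det =
      LinearMap.det T' * G.det * (Matrix.of fun i j => (E (evalEquiv φ (vt i))).1 j).det ^ 2 := by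
  set S : ℝ := ((ε : ℤ) : ℝ) with hS
  have hSS : S * S = 1 := by
    rcases Int.units_eq_one_or ε with h | h <;> simp [hS, h]
  obtain ⟨T, hT⟩ : ∃ T : V →ₗ[ℝ] V, ∀ x, T x = φ gen x - x := ⟨φ gen - 1, fun _ => rfl⟩
  simp only [← hT] at hE
  have hcob : ∀ f, evalEquiv φ (coboundary φ f) = T (evalEquiv φ f) := fun f => by
    rw [coboundary_apply_zero, hT]
  -- the representatives of `H⁰` are the invariant vectors
  have hut : ∀ j, T (evalEquiv φ (ut j)) = 0 := by
    intro j
    rw [← hcob, h.repr_u, LinearMap.mem_ker.1 (u j).2, map_zero]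
  have hu2 : ∀ j, (E (evalEquiv φ (ut j))).2 = 0 := by
    intro j
    have h1 := hE (evalEquiv φ (ut j))
    have h2 := hut j
    rw [h2, map_zero] at h1
    have h3 : T' (E (evalEquiv φ (ut j))).2 = 0 := (congrArg Prod.snd h1).symm
    have h4 : LinearMap.ker T' = ⊥ := by
      by_contra h5
      exact hT' (LinearMap.det_eq_zero_iff_ker_ne_bot.2 h5)
    exact (LinearMap.ker_eq_bot'.1 h4) _ h3
  have hdet := det_append_ne_zero φ m h
  have htor : tor φ m bt ut vt * (Matrix.of fun i j => (E (evalEquiv φ (ut j))).1 i).det =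
      LinearMap.det T' * (Matrix.of fun i j => (E (evalEquiv φ (vt i))).1 j).det := by
    have key := tor_identity hk m E T T' hE (fun i => evalEquiv φ (bt i))
      (fun i => evalEquiv φ (ut i)) (fun i => evalEquiv φ (vt i)) hu2
    have e1 : ((geomBasis φ m).reindex (finCongr (Nat.add_comm k r))).det
        (Fin.append vt fun i => coboundary φ (bt i)) =
        (m.reindex (finCongr (Nat.add_comm k r))).det (Fin.append (fun i => evalEquiv φ (vt i))
          fun i => T (evalEquiv φ (bt i))) := by
      rw [geomBasis, Module.Basis.det_reindex, Module.Basis.det_reindex, Module.Basis.det_map]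
      congr 1
      funext i
      rw [LinearEquiv.symm_symm, Function.comp_apply, Function.comp_apply, Function.comp_apply]
      generalize finCongr (Nat.add_comm k r) i = j
      refine Fin.addCases (fun a => ?_) (fun a => ?_) j <;> simp [hcob]
    have e2 : (geomBasis φ m).det (Fin.append bt ut) =
        m.det (Fin.append (fun i => evalEquiv φ (bt i)) fun i => evalEquiv φ (ut i)) := by
      rw [geomBasis, Module.Basis.det_map]
      congr 1
      funext i
      refine Fin.addCases (fun a => ?_) (fun a => ?_) i <;> simp
    rw [tor, e1, e2, div_mul_eq_mul_div, key, mul_div_assoc, div_self hdet, mul_one,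
      ← Matrix.det_transpose (Matrix.of fun i j => (E (evalEquiv φ (vt i))).1 j)]
    rfl
  have hpair : (Matrix.of fun i j => pairing φ B hB ε (v i) (u j)) =
      S • ((Matrix.of fun i j => (E (evalEquiv φ (vt i))).1 j) * G *
        (Matrix.of fun i j => (E (evalEquiv φ (ut j))).1 i)) := by
    ext i j
    rw [Matrix.mul_assoc, Matrix.smul_apply, Matrix.mul_apply, Matrix.of_apply, ← h.repr_v i]
    show S • B (evalEquiv φ (vt i)) (evalEquiv φ (u j : Cochain φ)) = _
    rw [← h.repr_u j, hG _ _ (hu2 j)]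
    rfl
  have hH1 : Module.finrank ℝ (H1 φ) = r := by simp [Module.finrank_eq_card_basis v]
  have hH0 : Module.finrank ℝ (H0 φ) = r := by simp [Module.finrank_eq_card_basis u]
  have hV : Module.finrank ℝ V = k + r := by simp [Module.finrank_eq_card_basis m]
  have hexp : (-1 : ℝ) ^ turaevExponent φ = (-1) ^ r := by
    rw [turaevExponent, hH0, hH1, (evalEquiv φ).finrank_eq, hV]
    rw [neg_one_pow_congr]
    simp only [Nat.even_add, Nat.even_mul, hk]
    tauto
  have hsgn : (-S) ^ (k + r) = (-1) ^ r * S ^ r := by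
    rw [neg_pow, pow_add, pow_add, hk.neg_one_pow, one_mul]
    obtain ⟨l, rfl⟩ := hk
    rw [pow_add S, ← mul_pow, hSS, one_pow, one_mul]
  -- for even `k` the total sign is `(-1)^r (-ε)^(k + r) ε^r = 1`
  rw [TOR, Tor, sign_trivialTor, ← hS, hV, hexp, hsgn, hpair, Matrix.det_smul, Fintype.card_fin,
    Matrix.det_mul, Matrix.det_mul]
  have hr1 : ((-1 : ℝ) ^ r) * (-1) ^ r = 1 := by rw [← mul_pow]; simp
  have hr2 : S ^ r * S ^ r = 1 := by rw [← mul_pow, hSS, one_pow]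
  calc _ = ((-1 : ℝ) ^ r * (-1) ^ r) * (S ^ r * S ^ r) *
        (tor φ m bt ut vt * (Matrix.of fun i j => (E (evalEquiv φ (ut j))).1 i).det) *
          (Matrix.of fun i j => (E (evalEquiv φ (vt i))).1 j).det * G.det := by ring
    _ = _ := by rw [hr1, hr2, htor]; ring

theorem wedge_apply {V : Type*} [AddCommGroup V] [Module ℝ V] {r : ℕ}
    (ω : Fin r → Module.Dual ℝ V) (v : Fin r → V) :
    wedge ω v = (Matrix.of fun i j => ω j (v i)).det := rfl

theorem exists_adapted_bases {C : Type*} [AddCommGroup C] [Module ℝ C] [FiniteDimensional ℝ C]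
    (d : C →ₗ[ℝ] C) {k r : ℕ} (hC : Module.finrank ℝ C = k + r)
    (h0 : Module.finrank ℝ (LinearMap.ker d) = r) :
    ∃ (_ : Module.Basis (Fin r) ℝ (LinearMap.ker d))
      (v : Module.Basis (Fin r) ℝ (C ⧸ LinearMap.range d)) (bt : Fin k → C) (vt : Fin r → C),
      LinearIndependent ℝ (fun i => d (bt i)) ∧
      Submodule.span ℝ (Set.range fun i => d (bt i)) = LinearMap.range d ∧
      (∀ i, (LinearMap.range d).mkQ (vt i) = v i) := by
  have hr : Module.finrank ℝ (LinearMap.range d) = k := by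
    have := LinearMap.finrank_range_add_finrank_ker d
    omega
  have h1 : Module.finrank ℝ (C ⧸ LinearMap.range d) = r := by
    have := (LinearMap.range d).finrank_quotient_add_finrank
    omega
  let c := Module.finBasisOfFinrankEq ℝ (LinearMap.range d) hr
  let v := Module.finBasisOfFinrankEq ℝ (C ⧸ LinearMap.range d) h1
  let u := Module.finBasisOfFinrankEq ℝ (LinearMap.ker d) h0
  choose bt hbt using fun i => LinearMap.mem_range.1 (c i).2
  choose vt hvt using fun i => (LinearMap.range d).mkQ_surjective (v i)
  refine ⟨u, v, bt, vt, ?_, ?_, hvt⟩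
  · simp only [hbt]
    exact linearIndependent_coe_basis c
  · simp only [hbt]
    have h2 := congrArg (Submodule.map (LinearMap.range d).subtype) c.span_eq
    rw [Submodule.map_span, Submodule.map_top, Submodule.range_subtype, ← Set.range_comp] at h2
    exact h2

/-- Admissible choices exist: the coordinates `E` show that `H⁰` and `H¹` have dimension `r`. -/
theorem exists_isTorsionData {V W : Type*} [AddCommGroup V] [Module ℝ V] [AddCommGroup W]
    [Module ℝ W] [FiniteDimensional ℝ W] (φ : Representation ℝ CircleGroup V) {r : ℕ}
    (E : V ≃ₗ[ℝ] (Fin r → ℝ) × W) (T' : W →ₗ[ℝ] W) (hT' : LinearMap.det T' ≠ 0)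
    (hE : ∀ x, E (φ gen x - x) = (0, T' (E x).2)) :
    ∃ (u : Module.Basis (Fin r) ℝ (H0 φ)) (v : Module.Basis (Fin r) ℝ (H1 φ))
      (_ : Module.Basis (Fin (Module.finrank ℝ W + r)) ℝ V)
      (bt : Fin (Module.finrank ℝ W) → Cochain φ) (ut vt : Fin r → Cochain φ),
      IsTorsionData φ u v bt ut vt := by
  have hfin : FiniteDimensional ℝ V := E.symm.finiteDimensional
  have hfin' : FiniteDimensional ℝ (Cochain φ) := (evalEquiv φ).symm.finiteDimensional
  have hV : Module.finrank ℝ V = Module.finrank ℝ W + r := by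
    rw [E.finrank_eq, Module.finrank_prod, Module.finrank_pi, Fintype.card_fin, add_comm]
  have hC : Module.finrank ℝ (Cochain φ) = Module.finrank ℝ W + r := by
    rw [(evalEquiv φ).finrank_eq, hV]
  have hker : LinearMap.ker (coboundary φ) = LinearMap.ker
      (LinearMap.snd ℝ (Fin r → ℝ) W ∘ₗ E.toLinearMap ∘ₗ (evalEquiv φ).toLinearMap) := by
    have h4 : LinearMap.ker T' = ⊥ := by
      by_contra h5
      exact hT' (LinearMap.det_eq_zero_iff_ker_ne_bot.2 h5)
    ext f
    rw [LinearMap.mem_ker, LinearMap.mem_ker, ← (evalEquiv φ).map_eq_zero_iff,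
      coboundary_apply_zero, ← E.map_eq_zero_iff, hE]
    show ((0, T' (E (evalEquiv φ f)).2) : (Fin r → ℝ) × W) = 0 ↔ (E (evalEquiv φ f)).2 = 0
    rw [Prod.mk_eq_zero, ← LinearMap.mem_ker (f := T'), h4, Submodule.mem_bot]
    simp
  have h0 : Module.finrank ℝ (LinearMap.ker (coboundary φ)) = r := by
    have h1 := LinearMap.finrank_range_add_finrank_ker
      (LinearMap.snd ℝ (Fin r → ℝ) W ∘ₗ E.toLinearMap ∘ₗ (evalEquiv φ).toLinearMap)
    rw [← hker, LinearMap.range_eq_top.2, finrank_top, hC] at h1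
    · omega
    · exact Prod.snd_surjective.comp (E.surjective.comp (evalEquiv φ).surjective)
  obtain ⟨u, v, bt, vt, h1, h2, h3⟩ := exists_adapted_bases (coboundary φ) hC h0
  exact ⟨u, v, Module.finBasisOfFinrankEq ℝ V hV, bt, fun i => u i, vt, h1, h2, fun _ => rfl, h3⟩

/-- If `φ t - 1` becomes `0 × T'` in the coordinates `E`, with `T'` invertible, then the peripheral
form is, up to sign, the coordinate volume form `∧ dθ` on `H¹` times the square root of
`det T' * det G`, for `G` the Gram matrix of `B` on the invariant vectors. -/
theorem isPeripheralForm_iff {V W : Type*} [AddCommGroup V] [Module ℝ V] [AddCommGroup W]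
    [Module ℝ W] [FiniteDimensional ℝ W]
    (φ : Representation ℝ CircleGroup V) (B : LinearMap.BilinForm ℝ V)
    (hB : ∀ γ x y, B (φ γ x) (φ γ y) = B x y) {r : ℕ} (hW : Even (Module.finrank ℝ W))
    (E : V ≃ₗ[ℝ] (Fin r → ℝ) × W) (T' : W →ₗ[ℝ] W) (hT' : LinearMap.det T' ≠ 0)
    (hE : ∀ x, E (φ gen x - x) = (0, T' (E x).2)) (G : Matrix (Fin r) (Fin r) ℝ)
    (hG : ∀ x y, (E y).2 = 0 → B x y = (E x).1 ⬝ᵥ (G.mulVec (E y).1))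
    (c : ℝ) (hc : LinearMap.det T' * G.det = c ^ 2) (dθ : Fin r → Module.Dual ℝ (H1 φ))
    (hdθ : ∀ i x, dθ i (classOf φ x) = (E x).1 i) (ν : H1 φ [⋀^Fin r]→ₗ[ℝ] ℝ) :
    IsPeripheralForm φ B hB ν ↔ ∃ s : ℤˣ, ν = (((s : ℤ) : ℝ) * c) • wedge dθ := by
  have key : ∀ (ε : ℤˣ) (u : Module.Basis (Fin r) ℝ (H0 φ)) (v : Module.Basis (Fin r) ℝ (H1 φ))
      (k : ℕ) (m : Module.Basis (Fin (k + r)) ℝ V) (bt : Fin k → Cochain φ)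
      (ut vt : Fin r → Cochain φ), IsTorsionData φ u v bt ut vt →
      TOR φ ε m bt ut vt * (Matrix.of fun i j => pairing φ B hB ε (v i) (u j)).det =
        (c * wedge dθ v) ^ 2 := by
    intro ε u v k m bt ut vt h
    have hk : k = Module.finrank ℝ W := by
      have h1 := E.finrank_eq
      rw [Module.finrank_prod, Module.finrank_eq_card_basis m, Module.finrank_pi,
        Fintype.card_fin, Fintype.card_fin] at h1
      omega
    have hv : wedge dθ v = (Matrix.of fun i j => (E (evalEquiv φ (vt i))).1 j).det := by
      rw [wedge_apply]
      congr 2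
      funext i j
      rw [← hdθ, ← h.repr_v]
      simp [classOf]
    rw [TOR_mul_det_pairing φ B hB (hk ▸ hW) E T' hT' hE G hG ε u v m bt ut vt h, hc, hv, mul_pow]
  constructor
  · intro hν
    obtain ⟨u, v, m, bt, ut, vt, h⟩ := exists_isTorsionData φ E T' hT' hE
    have h1 := hν 1 u v _ m bt ut vt h
    rw [key 1 u v _ m bt ut vt h, sq_eq_sq_iff_eq_or_eq_neg] at h1
    have h2 : ∃ s : ℤˣ, ν v = (((s : ℤ) : ℝ) * c) • wedge dθ v := by
      rcases h1 with h1 | h1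
      · exact ⟨1, by rw [h1]; simp⟩
      · exact ⟨-1, by rw [h1]; simp⟩
    obtain ⟨s, hs⟩ := h2
    refine ⟨s, ?_⟩
    rw [AlternatingMap.eq_smul_basis_det v ν,
      AlternatingMap.eq_smul_basis_det v ((((s : ℤ) : ℝ) * c) • wedge dθ), hs,
      AlternatingMap.smul_apply]
  · rintro ⟨s, rfl⟩ ε u v k m bt ut vt h
    rw [key ε u v k m bt ut vt h, AlternatingMap.smul_apply, smul_eq_mul, mul_assoc, mul_pow]
    rcases Int.units_eq_one_or s with rfl | rfl <;> simp

/-! ### Coordinates on `su(n + 1)` -/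

/-- The index set of the upper triangular off-diagonal entries. -/
abbrev UpperPairs (n : ℕ) : Type := {p : Fin (n + 1) × Fin (n + 1) // p.1 < p.2}

theorem su_apply_swap {N : ℕ} (X : su N) (i j : Fin N) : X.1 j i = -star (X.1 i j) := by
  have h := congrFun (congrFun X.2.1 j) i
  rw [Matrix.conjTranspose_apply, Matrix.neg_apply] at h
  rw [h, neg_neg]

/-- The diagonal entries of a skew-Hermitian matrix are purely imaginary. -/
theorem su_diag {N : ℕ} (X : su N) (i : Fin N) :
    X.1 i i = Complex.I * ((X.1 i i).im : ℂ) := by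
  have h := congrArg Complex.re (su_apply_swap X i i)
  simp at h
  apply Complex.ext
  · simp
    linarith
  · simp

theorem su_sum_im {N : ℕ} (X : su N) : ∑ i, (X.1 i i).im = 0 := by
  have h := congrArg Complex.im X.2.2
  simpa [Matrix.trace] using h

theorem su_im_last {n : ℕ} (X : su (n + 1)) :
    (X.1 (Fin.last n) (Fin.last n)).im = -∑ i : Fin n, (X.1 i.castSucc i.castSucc).im := by
  have h := su_sum_im X
  rw [Fin.sum_univ_castSucc] at h
  linarith

/-- The skew-Hermitian matrix with diagonal `i d` and upper triangular entries `z`. -/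
noncomputable def skewOf {n : ℕ} (d : Fin (n + 1) → ℝ) (z : UpperPairs n → ℂ) :
    Matrix (Fin (n + 1)) (Fin (n + 1)) ℂ :=
  Matrix.of fun i j => if h : i < j then z ⟨(i, j), h⟩ else
    if h : j < i then -star (z ⟨(j, i), h⟩) else Complex.I * d i

theorem skewOf_mem {n : ℕ} (d : Fin (n + 1) → ℝ) (hd : ∑ i, d i = 0) (z : UpperPairs n → ℂ) :
    skewOf d z ∈ su (n + 1) := by
  constructor
  · ext i j
    rw [Matrix.conjTranspose_apply, Matrix.neg_apply, skewOf, Matrix.of_apply, Matrix.of_apply]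
    rcases lt_trichotomy i j with h | rfl | h
    · simp [h, h.not_gt]
    · simp
    · simp [h, h.not_gt]
  · simp [skewOf, Matrix.trace, ← Finset.mul_sum, ← Complex.ofReal_sum, hd]

/-- Linear coordinates on `su(n + 1)`: the imaginary parts of the diagonal entries except the last
one, and the upper triangular off-diagonal entries. -/
noncomputable def suCoords (n : ℕ) : su (n + 1) ≃ₗ[ℝ] (Fin n → ℝ) × (UpperPairs n → ℂ) where
  toFun X := (fun i => (X.1 i.castSucc i.castSucc).im, fun p => X.1 p.1.1 p.1.2)
  map_add' X Y := by
    ext <;> simp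
  map_smul' c X := by
    ext <;> simp
  invFun x := ⟨skewOf (Fin.snoc x.1 (-∑ i, x.1 i)) x.2, skewOf_mem _ (by
    simp [Fin.sum_univ_castSucc]) _⟩
  left_inv X := by
    apply Subtype.ext
    ext i j
    simp only [skewOf, Matrix.of_apply]
    rcases lt_trichotomy i j with h | rfl | h
    · simp [h]
    · rw [su_diag X i]
      simp only [lt_irrefl, dite_false]
      congr 2
      refine Fin.lastCases ?_ (fun i => ?_) i
      · rw [Fin.snoc_last, su_im_last]
      · rw [Fin.snoc_castSucc]
    · simp only [h, h.not_gt, dite_false, dite_true]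
      exact (su_apply_swap X j i).symm
  right_inv x := by
    ext p
    · simp [skewOf]
    · simp [skewOf, p.2]

/-- Conjugation `X ↦ P⁻¹ X P` by a unitary matrix, on `su(N)`. -/
noncomputable def suConj {N : ℕ} (P : Matrix (Fin N) (Fin N) ℂ)
    (hP : P ∈ Matrix.unitaryGroup (Fin N) ℂ) : su N ≃ₗ[ℝ] su N where
  toFun X := ⟨star P * X.1 * P, by
    refine ⟨?_, ?_⟩
    · rw [Matrix.star_eq_conjTranspose, Matrix.conjTranspose_mul, Matrix.conjTranspose_mul,
        Matrix.conjTranspose_conjTranspose, X.2.1, Matrix.neg_mul, Matrix.mul_neg, Matrix.mul_assoc]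
    · rw [Matrix.trace_mul_comm, ← Matrix.mul_assoc, Matrix.mem_unitaryGroup_iff.1 hP,
        Matrix.one_mul, X.2.2]⟩
  map_add' X Y := by
    apply Subtype.ext
    simp [Matrix.mul_add, Matrix.add_mul]
  map_smul' c X := by
    apply Subtype.ext
    simp
  invFun X := ⟨P * X.1 * star P, by
    refine ⟨?_, ?_⟩
    · rw [Matrix.star_eq_conjTranspose, Matrix.conjTranspose_mul, Matrix.conjTranspose_mul,
        Matrix.conjTranspose_conjTranspose, X.2.1, Matrix.neg_mul, Matrix.mul_neg, Matrix.mul_assoc]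
    · rw [Matrix.trace_mul_comm, ← Matrix.mul_assoc, Matrix.mem_unitaryGroup_iff'.1 hP,
        Matrix.one_mul, X.2.2]⟩
  left_inv X := by
    apply Subtype.ext
    calc P * (star P * X.1 * P) * star P = (P * star P) * X.1 * (P * star P) := by
          simp only [Matrix.mul_assoc]
      _ = X.1 := by rw [Matrix.mem_unitaryGroup_iff.1 hP, Matrix.one_mul, Matrix.mul_one]
  right_inv X := by
    apply Subtype.ext
    calc star P * (P * X.1 * star P) * P = (star P * P) * X.1 * (star P * P) := by
          simp only [Matrix.mul_assoc]
      _ = X.1 := by rw [Matrix.mem_unitaryGroup_iff'.1 hP, Matrix.one_mul, Matrix.mul_one]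

theorem traceForm_suConj {N : ℕ} (P : Matrix (Fin N) (Fin N) ℂ)
    (hP : P ∈ Matrix.unitaryGroup (Fin N) ℂ) (X Y : su N) :
    traceForm N (suConj P hP X) (suConj P hP Y) = traceForm N X Y := by
  show -(Matrix.trace ((star P * X.1 * P) * (star P * Y.1 * P))).re = -(Matrix.trace (X.1 * Y.1)).re
  rw [show (star P * X.1 * P) * (star P * Y.1 * P) = star P * (X.1 * (P * star P) * Y.1 * P) by
    simp only [Matrix.mul_assoc], Matrix.mem_unitaryGroup_iff.1 hP, Matrix.trace_mul_comm,
    Matrix.mul_one, Matrix.mul_assoc, Matrix.mem_unitaryGroup_iff.1 hP, Matrix.mul_one]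

/-- The Gram matrix of the trace form on the diagonal matrices of `su(r + 1)`, in the basis
`i (E_jj - E_{r+1,r+1})`. -/
def gram (r : ℕ) : Matrix (Fin r) (Fin r) ℝ :=
  1 + Matrix.of fun _ _ => 1

theorem det_gram (r : ℕ) : (gram r).det = r + 1 := by
  have h : (Matrix.of fun _ _ => 1 : Matrix (Fin r) (Fin r) ℝ) =
      Matrix.replicateCol Unit (fun _ => (1 : ℝ)) *
        Matrix.replicateRow Unit (fun _ => (1 : ℝ)) := by
    ext i j
    simp [Matrix.mul_apply]
  rw [gram, h, Matrix.det_one_add_replicateCol_mul_replicateRow]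
  simp [dotProduct, add_comm]

theorem traceForm_eq_gram {n : ℕ} (X Y : su (n + 1)) (hY : (suCoords n Y).2 = 0) :
    traceForm (n + 1) X Y = (suCoords n X).1 ⬝ᵥ ((gram n).mulVec (suCoords n Y).1) := by
  have hoff : ∀ i j, i ≠ j → Y.1 i j = 0 := by
    have h1 : ∀ i j, i < j → Y.1 i j = 0 := fun i j h => congrFun hY ⟨(i, j), h⟩
    intro i j hij
    rcases lt_or_gt_of_ne hij with h | h
    · exact h1 i j h
    · rw [su_apply_swap, h1 j i h, star_zero, neg_zero]
  have htr : Matrix.trace (X.1 * Y.1) = ∑ i, X.1 i i * Y.1 i i := by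
    rw [Matrix.trace]
    refine Finset.sum_congr rfl fun i _ => ?_
    rw [Matrix.diag_apply, Matrix.mul_apply]
    exact Finset.sum_eq_single i (fun j _ hj => by rw [hoff j i hj, mul_zero]) (by simp)
  have h2 : traceForm (n + 1) X Y = ∑ i, (X.1 i i).im * (Y.1 i i).im := by
    show -(Matrix.trace (X.1 * Y.1)).re = _
    rw [htr, Complex.re_sum, ← Finset.sum_neg_distrib]
    refine Finset.sum_congr rfl fun i _ => ?_
    rw [su_diag X i, su_diag Y i]
    simp
  rw [h2, Fin.sum_univ_castSucc, su_im_last, su_im_last, gram, Matrix.add_mulVec, Matrix.one_mulVec,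
    dotProduct_add]
  congr 1
  rw [neg_mul_neg]
  simp [dotProduct, Matrix.mulVec, Finset.sum_mul, suCoords]

/-- Multiplication of the upper triangular entries by `λ_i λ̄_j - 1`: the off-diagonal part of
`Ad g - 1` for `g` with eigenvalues `λ`. -/
noncomputable def offDiag {n : ℕ} (lam : Fin (n + 1) → ℂ) :
    (UpperPairs n → ℂ) →ₗ[ℝ] (UpperPairs n → ℂ) :=
  LinearMap.pi fun p =>
    (LinearMap.mulLeft ℝ (lam p.1.1 * star (lam p.1.2) - 1)).comp (LinearMap.proj p)

theorem det_offDiag {n : ℕ} (lam : Fin (n + 1) → ℂ) :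
    LinearMap.det (offDiag lam) =
      ∏ p : UpperPairs n, Complex.normSq (lam p.1.1 * star (lam p.1.2) - 1) := by
  rw [offDiag, LinearMap.det_pi]
  exact Finset.prod_congr rfl fun p _ => Algebra.norm_complex_apply _

/-- The chord `|e^{i(a-b)} - 1| = 2 |sin ((a - b) / 2)|`. -/
theorem normSq_exp_mul_star_exp_sub_one (a b : ℝ) :
    Complex.normSq (Complex.exp (Complex.I * a) * star (Complex.exp (Complex.I * b)) - 1) =
      (2 * Real.sin ((a - b) / 2)) ^ 2 := by
  have h : Complex.exp (Complex.I * a) * star (Complex.exp (Complex.I * b)) =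
      Complex.exp ((((a - b : ℝ) : ℂ)) * Complex.I) := by
    rw [Complex.star_def, ← Complex.exp_conj, ← Complex.exp_add]
    congr 1
    simp
    ring
  have h1 : Real.cos (a - b) = 1 - 2 * Real.sin ((a - b) / 2) ^ 2 := by
    rw [show a - b = 2 * ((a - b) / 2) by ring, Real.cos_two_mul', Real.cos_sq']
    rw [show 2 * ((a - b) / 2) / 2 = (a - b) / 2 by ring]
    ring
  rw [h, Complex.normSq_apply]
  simp only [Complex.sub_re, Complex.sub_im, Complex.exp_ofReal_mul_I_re,
    Complex.exp_ofReal_mul_I_im, Complex.one_re, Complex.one_im]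
  have h2 := Real.sin_sq_add_cos_sq (a - b)
  nlinarith

/-- Products over pairs `i < j`, as iterated products. -/
theorem prod_upperPairs {n : ℕ} (f : Fin (n + 1) → Fin (n + 1) → ℝ) :
    ∏ p : UpperPairs n, f p.1.1 p.1.2 = ∏ i, ∏ j ∈ Finset.Ioi i, f i j := by
  rw [← Finset.prod_subtype (Finset.univ.filter fun p : Fin (n + 1) × Fin (n + 1) => p.1 < p.2)
    (by simp) fun p => f p.1 p.2, Finset.prod_filter, Fintype.prod_prod_type]
  refine Finset.prod_congr rfl fun i _ => ?_
  rw [← Finset.prod_filter]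
  refine Finset.prod_congr ?_ fun _ _ => rfl
  ext j
  simp

theorem card_upperPairs (n : ℕ) : Fintype.card (UpperPairs n) = (n + 1) * n / 2 := by
  have h := prod_upperPairs (n := n) fun _ _ => 2
  simp only [Finset.prod_const, Fin.card_Ioi, Finset.card_univ] at h
  rw [Finset.prod_pow_eq_pow_sum] at h
  have h1 := pow_right_injective₀ (M₀ := ℝ) (a := 2) (by norm_num) (by norm_num) h
  rw [h1, Fin.sum_univ_eq_sum_range (fun i => n + 1 - 1 - i)]
  have h2 := Finset.sum_range_reflect (fun i => i) (n + 1)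
  rw [h2, Finset.sum_range_id, Nat.add_sub_cancel]

theorem det_offDiag_exp {n : ℕ} (θ : Fin (n + 1) → ℝ) :
    LinearMap.det (offDiag fun i => Complex.exp (Complex.I * θ i)) =
      (2 ^ ((n + 1) * n / 2) * ∏ i, ∏ j ∈ Finset.Ioi i, Real.sin ((θ i - θ j) / 2)) ^ 2 := by
  rw [det_offDiag]
  simp only [normSq_exp_mul_star_exp_sub_one]
  rw [Finset.prod_pow, Finset.prod_mul_distrib, Finset.prod_const, Finset.card_univ,
    card_upperPairs, prod_upperPairs fun i j => Real.sin ((θ i - θ j) / 2)]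

theorem even_finrank_upperPairs (n : ℕ) : Even (Module.finrank ℝ (UpperPairs n → ℂ)) := by
  rw [Module.finrank_pi_fintype]
  simp [Complex.finrank_real_complex]

/-- Coordinates on `su(n + 1)` in which `Ad g - 1` is diagonal, for `g` diagonalised by `P`. -/
noncomputable def frameCoords {n : ℕ} (P : Matrix (Fin (n + 1)) (Fin (n + 1)) ℂ)
    (hP : P ∈ Matrix.unitaryGroup (Fin (n + 1)) ℂ) :
    su (n + 1) ≃ₗ[ℝ] (Fin n → ℝ) × (UpperPairs n → ℂ) :=
  (suConj P hP).trans (suCoords n)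

/-- In the eigenbasis of `g`, the operator `Ad g - 1` multiplies the `(i, j)` entry by
`λ_i λ̄_j - 1`. -/
theorem suConj_Ad_sub_apply {N : ℕ} {P : Matrix (Fin N) (Fin N) ℂ}
    (hP : P ∈ Matrix.unitaryGroup (Fin N) ℂ) {lam : Fin N → ℂ} {g : SU N}
    (hg : (g : Matrix (Fin N) (Fin N) ℂ) = P * Matrix.diagonal lam * star P)
    (X : su N) (i j : Fin N) :
    (suConj P hP (Ad N g X - X)).1 i j =
      (lam i * star (lam j) - 1) * (suConj P hP X).1 i j := by
  have h1 : (suConj P hP (Ad N g X)).1 =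
      Matrix.diagonal lam * (suConj P hP X).1 * Matrix.diagonal (star lam) := by
    show star P * ((g : Matrix (Fin N) (Fin N) ℂ) * X.1 *
      star (g : Matrix (Fin N) (Fin N) ℂ)) * P = _
    rw [hg, star_mul, star_mul, star_star, Matrix.star_eq_conjTranspose (Matrix.diagonal lam),
      Matrix.diagonal_conjTranspose]
    calc _ = (star P * P) * (Matrix.diagonal lam * (star P * X.1 * P) *
          Matrix.diagonal (star lam)) * (star P * P) := by simp only [Matrix.mul_assoc]
      _ = _ := by
        rw [Matrix.mem_unitaryGroup_iff'.1 hP, Matrix.one_mul, Matrix.mul_one]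
        rfl
  rw [map_sub]
  show (suConj P hP (Ad N g X)).1 i j - (suConj P hP X).1 i j = _
  rw [h1, Matrix.mul_diagonal, Matrix.diagonal_mul, Pi.star_apply]
  ring

theorem frameCoords_Ad {n : ℕ} {P : Matrix (Fin (n + 1)) (Fin (n + 1)) ℂ}
    (hP : P ∈ Matrix.unitaryGroup (Fin (n + 1)) ℂ) {lam : Fin (n + 1) → ℂ}
    (hlam : ∀ i, lam i * star (lam i) = 1) {g : SU (n + 1)}
    (hg : (g : Matrix (Fin (n + 1)) (Fin (n + 1)) ℂ) = P * Matrix.diagonal lam * star P)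
    (X : su (n + 1)) :
    frameCoords P hP (Ad (n + 1) g X - X) = (0, offDiag lam (frameCoords P hP X).2) := by
  ext p
  · show ((suConj P hP (Ad (n + 1) g X - X)).1 _ _).im = 0
    rw [suConj_Ad_sub_apply hP hg, hlam, sub_self, zero_mul, Complex.zero_im]
  · exact suConj_Ad_sub_apply hP hg X _ _

/-! ### Diagonalisation and regular elements -/

/-- The unit circle is infinite, so it is not contained in the spectrum. -/
theorem exists_unit_det_sub_ne_zero {N : ℕ} (g : Matrix (Fin N) (Fin N) ℂ) :
    ∃ z : ℂ, z * star z = 1 ∧ IsUnit (z • (1 : Matrix (Fin N) (Fin N) ℂ) - g).det := by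
  have hinf : (Metric.sphere (0 : ℂ) 1).Infinite := by
    refine (isPreconnected_sphere ?_ 0 1).infinite_of_nontrivial ⟨1, by simp, -1, by simp, ?_⟩
    · rw [Complex.rank_real_complex]
      norm_num
    · norm_num
  obtain ⟨z, hz, hz'⟩ : ∃ z ∈ Metric.sphere (0 : ℂ) 1, ¬ g.charpoly.IsRoot z := by
    by_contra! h
    exact g.charpoly_monic.ne_zero (Polynomial.eq_zero_of_infinite_isRoot _ (hinf.mono h))
  refine ⟨z, ?_, ?_⟩
  · rw [mem_sphere_zero_iff_norm] at hz
    rw [Complex.star_def, Complex.mul_conj, Complex.normSq_eq_norm_sq, hz]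
    simp
  · rw [isUnit_iff_ne_zero]
    intro h
    apply hz'
    rw [Polynomial.IsRoot, Matrix.eval_charpoly, Matrix.scalar_apply,
      ← Matrix.smul_one_eq_diagonal, h]

/-- Unitary matrices are unitarily diagonalisable. The Cayley transform turns the unitary matrix
into a Hermitian one, whose eigenvectors are eigenvectors of the unitary matrix. -/
theorem exists_unitary_diagonalization {N : ℕ} {g : Matrix (Fin N) (Fin N) ℂ}
    (hg : g ∈ Matrix.unitaryGroup (Fin N) ℂ) :
    ∃ P ∈ Matrix.unitaryGroup (Fin N) ℂ, ∃ lam : Fin N → ℂ, (∀ i, lam i * star (lam i) = 1) ∧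
      g = P * Matrix.diagonal lam * star P := by
  obtain ⟨z, hz, hdet⟩ := exists_unit_det_sub_ne_zero g
  set M : Matrix (Fin N) (Fin N) ℂ := z • 1 - g with hM
  set Q : Matrix (Fin N) (Fin N) ℂ := z • 1 + g with hQ
  -- the Cayley transform `i (z + g) / (z - g)`
  set A := (Complex.I • Q) * M⁻¹ with hA
  have hAM : A * M = Complex.I • Q := by rw [hA, Matrix.nonsing_inv_mul_cancel_right _ _ hdet]
  have hg1 : star g * g = 1 := Matrix.mem_unitaryGroup_iff'.1 hg
  have hg2 : g * star g = 1 := Matrix.mem_unitaryGroup_iff.1 hg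
  have hdet2 : IsUnit (star M).det := by
    rw [Matrix.star_eq_conjTranspose, Matrix.det_conjTranspose]
    exact hdet.star
  have hMM : star M * (A * M) = star M * (star A * M) := by
    have h1 : star M * star A = star (A * M) := (star_mul _ _).symm
    rw [← Matrix.mul_assoc _ (star A), h1, hAM, hM, hQ]
    simp only [star_sub, star_smul, star_add, star_one, Matrix.sub_mul, Matrix.mul_sub,
      Matrix.add_mul, Matrix.mul_add, Matrix.smul_mul, Matrix.mul_smul, smul_smul, hg1,
      Matrix.one_mul, Matrix.mul_one, smul_add, smul_sub, star_mul', Complex.star_def,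
      Complex.conj_I]
    rw [Complex.star_def] at hz
    match_scalars <;> first | ring1 | linear_combination 2 * Complex.I * hz
  have hherm : A.IsHermitian := by
    have h2 : A * M = star A * M := by
      have := congrArg (fun Z => (star M)⁻¹ * Z) hMM
      simpa only [Matrix.nonsing_inv_mul_cancel_left _ _ hdet2] using this
    have := congrArg (fun Z => Z * M⁻¹) h2
    simp only [Matrix.mul_nonsing_inv_cancel_right _ _ hdet] at this
    exact this.symm
  set U : Matrix (Fin N) (Fin N) ℂ := hherm.eigenvectorUnitary.1 with hU
  have hUmem : U ∈ Matrix.unitaryGroup (Fin N) ℂ := hherm.eigenvectorUnitary.2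
  have hU1 : star U * U = 1 := Matrix.mem_unitaryGroup_iff'.1 hUmem
  have hU2 : U * star U = 1 := Matrix.mem_unitaryGroup_iff.1 hUmem
  have hspec : A = U * Matrix.diagonal (fun i => (hherm.eigenvalues i : ℂ)) * star U := by
    conv_lhs => rw [hherm.spectral_theorem]
    rfl
  set B := star U * g * U with hB
  have hgB : g = U * B * star U := by
    calc g = (U * star U) * g * (U * star U) := by rw [hU2, Matrix.one_mul, Matrix.mul_one]
      _ = _ := by rw [hB]; simp only [Matrix.mul_assoc]
  have hBeq : Matrix.diagonal (fun i => (hherm.eigenvalues i : ℂ)) * (z • 1 - B) =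
      Complex.I • (z • 1 + B) := by
    have e1 : star U * (A * M) * U =
        Matrix.diagonal (fun i => (hherm.eigenvalues i : ℂ)) * (z • 1 - B) := by
      conv_lhs => rw [hspec]
      calc _ = (star U * U) * Matrix.diagonal (fun i => (hherm.eigenvalues i : ℂ)) *
            (star U * M * U) := by simp only [Matrix.mul_assoc]
        _ = _ := by
          rw [hU1, Matrix.one_mul, hM, Matrix.mul_sub, Matrix.sub_mul, Matrix.mul_smul,
            Matrix.mul_one, Matrix.smul_mul, hU1]
    have e2 : star U * (A * M) * U = Complex.I • (z • 1 + B) := by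
      rw [hAM, hQ, Matrix.mul_smul, Matrix.smul_mul, Matrix.mul_add, Matrix.add_mul,
        Matrix.mul_smul, Matrix.mul_one, Matrix.smul_mul, hU1]
    rw [← e1, e2]
  -- the `(i, j)` entry reads `(a_i + i) B_ij = 0`, with `a_i` real
  have hoff : ∀ i j, i ≠ j → B i j = 0 := by
    intro i j hij
    have h := congrFun (congrFun hBeq i) j
    rw [Matrix.diagonal_mul] at h
    simp only [Matrix.sub_apply, Matrix.add_apply, Matrix.smul_apply, Matrix.one_apply_ne hij,
      smul_eq_mul, mul_zero, zero_sub, zero_add] at h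
    have h2 : ((hherm.eigenvalues i : ℂ) + Complex.I) * B i j = 0 := by linear_combination -h
    rcases mul_eq_zero.1 h2 with h3 | h3
    · have := congrArg Complex.im h3
      simp at this
    · exact h3
  have hBdiag : B = Matrix.diagonal fun i => B i i := by
    ext i j
    by_cases h : i = j
    · subst h
      simp
    · rw [hoff i j h, Matrix.diagonal_apply_ne _ h]
  refine ⟨U, hUmem, fun i => B i i, ?_, by rw [← hBdiag, ← hgB]⟩
  have hBB : B * star B = 1 := by
    rw [hB, star_mul, star_mul, star_star]
    calc _ = star U * (g * (U * star U) * star g) * U := by simp only [Matrix.mul_assoc]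
      _ = 1 := by rw [hU2, Matrix.mul_one, hg2, Matrix.mul_one, hU1]
  intro i
  have h := congrFun (congrFun hBB i) i
  rw [hBdiag, Matrix.star_eq_conjTranspose, Matrix.diagonal_conjTranspose,
    Matrix.diagonal_mul_diagonal, Matrix.diagonal_apply_eq, Matrix.one_apply_eq] at h
  exact h

theorem charpoly_conj_diagonal {N : ℕ} {P : Matrix (Fin N) (Fin N) ℂ}
    (hP : P ∈ Matrix.unitaryGroup (Fin N) ℂ) (lam : Fin N → ℂ) :
    (P * Matrix.diagonal lam * star P).charpoly = ∏ j, (Polynomial.X - Polynomial.C (lam j)) := by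
  rw [Matrix.charpoly_mul_comm, ← Matrix.mul_assoc, Matrix.mem_unitaryGroup_iff'.1 hP,
    Matrix.one_mul, Matrix.charpoly_diagonal]

/-- `λ_i λ̄_j = 1` means `λ_i = λ_j` for unit complex numbers. -/
theorem ker_offDiag_eq_bot_iff {n : ℕ} {lam : Fin (n + 1) → ℂ}
    (hlam : ∀ i, lam i * star (lam i) = 1) :
    LinearMap.ker (offDiag lam) = ⊥ ↔ Function.Injective lam := by
  classical
  have hne : ∀ i j, lam i * star (lam j) = 1 ↔ lam i = lam j := by
    intro i j
    constructor
    · intro h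
      calc lam i = lam i * (lam j * star (lam j)) := by rw [hlam, mul_one]
        _ = (lam i * star (lam j)) * lam j := by ring
        _ = lam j := by rw [h, one_mul]
    · intro h
      rw [h, hlam]
  constructor
  · intro h
    have key : ∀ i j, i < j → lam i ≠ lam j := by
      intro i j hij he
      set w : UpperPairs n → ℂ := Pi.single ⟨(i, j), hij⟩ 1 with hw
      have h1 : w ∈ LinearMap.ker (offDiag lam) := by
        rw [LinearMap.mem_ker]
        funext p
        show (lam p.1.1 * star (lam p.1.2) - 1) * w p = 0
        by_cases hp : p = ⟨(i, j), hij⟩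
        · subst hp
          rw [(hne _ _).2 he, sub_self, zero_mul]
        · rw [hw, Pi.single_eq_of_ne hp, mul_zero]
      rw [h, Submodule.mem_bot] at h1
      simpa [hw] using congrFun h1 ⟨(i, j), hij⟩
    intro i j hij
    by_contra hne'
    rcases lt_or_gt_of_ne hne' with h1 | h1
    · exact key i j h1 hij
    · exact key j i h1 hij.symm
  · intro h
    rw [LinearMap.ker_eq_bot']
    intro z hz
    funext p
    have h1 : (lam p.1.1 * star (lam p.1.2) - 1) * z p = 0 := congrFun hz p
    rcases mul_eq_zero.1 h1 with h2 | h2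
    · exact absurd (h ((hne _ _).1 (sub_eq_zero.1 h2))) p.2.ne
    · exact h2

/-- The centralizer contains the maximal torus of dimension `n`; repeated eigenvalues add the kernel
of the off-diagonal part. -/
theorem centralizerDim_eq {n : ℕ} {P : Matrix (Fin (n + 1)) (Fin (n + 1)) ℂ}
    (hP : P ∈ Matrix.unitaryGroup (Fin (n + 1)) ℂ) {lam : Fin (n + 1) → ℂ}
    (hlam : ∀ i, lam i * star (lam i) = 1) {g : SU (n + 1)}
    (hg : (g : Matrix (Fin (n + 1)) (Fin (n + 1)) ℂ) = P * Matrix.diagonal lam * star P) :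
    centralizerDim g = n + Module.finrank ℝ (LinearMap.ker (offDiag lam)) := by
  set E := frameCoords P hP with hE
  have hfin : FiniteDimensional ℝ (su (n + 1)) := E.symm.finiteDimensional
  let F : su (n + 1) →ₗ[ℝ] (UpperPairs n → ℂ) :=
    LinearMap.snd ℝ (Fin n → ℝ) (UpperPairs n → ℂ) ∘ₗ E.toLinearMap
  have hF : Function.Surjective F := Prod.snd_surjective.comp E.surjective
  have hker : LinearMap.ker (Ad (n + 1) g - 1) = LinearMap.ker (offDiag lam ∘ₗ F) := by
    ext X
    rw [LinearMap.mem_ker, LinearMap.mem_ker, ← E.map_eq_zero_iff]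
    show E (Ad (n + 1) g X - X) = 0 ↔ offDiag lam (E X).2 = 0
    rw [hE, frameCoords_Ad hP hlam hg, Prod.mk_eq_zero]
    simp
  have h1 := LinearMap.finrank_range_add_finrank_ker (offDiag lam ∘ₗ F)
  have h2 := LinearMap.finrank_range_add_finrank_ker (offDiag lam)
  rw [LinearMap.range_comp_of_range_eq_top _ (LinearMap.range_eq_top.2 hF), E.finrank_eq,
    Module.finrank_prod, Module.finrank_fin_fun] at h1
  rw [centralizerDim, hker]
  omega

/-- Some element of `SU(n + 1)` has distinct eigenvalues. -/
theorem exists_SU_distinct (n : ℕ) : ∃ (h : SU (n + 1)) (lam : Fin (n + 1) → ℂ),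
    Function.Injective lam ∧ (∀ i, lam i * star (lam i) = 1) ∧
      (h : Matrix (Fin (n + 1)) (Fin (n + 1)) ℂ) = Matrix.diagonal lam := by
  -- the angles are centred so that their sum vanishes, and lie in `(-1, 1)`
  set t : Fin (n + 1) → ℝ := fun j => (2 * (j : ℝ) - n) / (n + 1) with ht
  have hn : (0 : ℝ) < n + 1 := by positivity
  have hsum : ∑ j, t j = 0 := by
    rw [ht, ← Finset.sum_div, Finset.sum_sub_distrib, ← Finset.mul_sum]
    rw [Fin.sum_univ_eq_sum_range (fun i => (i : ℝ)) (n + 1), Finset.sum_const, Finset.card_univ,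
      Fintype.card_fin]
    have h1 : (∑ i ∈ Finset.range (n + 1), (i : ℝ)) * 2 = (n + 1) * n := by
      have := Finset.sum_range_id_mul_two (n + 1)
      rw [Nat.add_sub_cancel] at this
      have h2 := congrArg (Nat.cast (R := ℝ)) this
      push_cast at h2
      exact h2
    rw [mul_comm 2, h1]
    simp
  set lam : Fin (n + 1) → ℂ := fun j => Complex.exp (t j * Complex.I) with hlam
  have hmod : ∀ i, lam i * star (lam i) = 1 := by
    intro i
    rw [Complex.star_def, Complex.mul_conj, Complex.normSq_eq_norm_sq, hlam]
    simp [Complex.norm_exp_ofReal_mul_I]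
  have hbound : ∀ j, -1 < t j ∧ t j < 1 := by
    intro j
    have h1 : (j : ℝ) ≤ n := by exact_mod_cast Nat.lt_succ_iff.1 j.2
    have h2 : (0 : ℝ) ≤ (j : ℝ) := by positivity
    constructor
    · rw [ht, lt_div_iff₀ hn]; linarith
    · rw [ht, div_lt_iff₀ hn]; linarith
  have hinj : Function.Injective lam := by
    intro i j hij
    have h1 := congrArg Complex.arg hij
    have hpi := Real.pi_gt_three
    simp only [hlam] at h1
    rw [Complex.arg_exp_mul_I, Complex.arg_exp_mul_I, (toIocMod_eq_self _).2,
      (toIocMod_eq_self _).2] at h1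
    · simp only [ht] at h1
      rw [div_left_inj' hn.ne'] at h1
      have h2 : (i : ℝ) = j := by linarith
      exact Fin.ext (by exact_mod_cast h2)
    · constructor <;> linarith [(hbound j).1, (hbound j).2]
    · constructor <;> linarith [(hbound i).1, (hbound i).2]
  refine ⟨⟨Matrix.diagonal lam, ?_⟩, lam, hinj, hmod, rfl⟩
  rw [Matrix.mem_specialUnitaryGroup_iff, Matrix.mem_unitaryGroup_iff]
  constructor
  · rw [Matrix.star_eq_conjTranspose, Matrix.diagonal_conjTranspose, Matrix.diagonal_mul_diagonal,
      ← Matrix.diagonal_one]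
    congr 1
    funext i
    exact hmod i
  · rw [Matrix.det_diagonal, hlam, ← Complex.exp_sum, ← Finset.sum_mul, ← Complex.ofReal_sum, hsum]
    simp

/-- Regular means distinct eigenvalues: the minimal centralizer dimension is `n`, and it is attained
by `exists_SU_distinct`. -/
theorem isRegular_iff_injective {n : ℕ} {P : Matrix (Fin (n + 1)) (Fin (n + 1)) ℂ}
    (hP : P ∈ Matrix.unitaryGroup (Fin (n + 1)) ℂ) {lam : Fin (n + 1) → ℂ}
    (hlam : ∀ i, lam i * star (lam i) = 1) {g : SU (n + 1)}
    (hg : (g : Matrix (Fin (n + 1)) (Fin (n + 1)) ℂ) = P * Matrix.diagonal lam * star P) :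
    IsRegular g ↔ Function.Injective lam := by
  rw [← ker_offDiag_eq_bot_iff hlam]
  constructor
  · intro h
    obtain ⟨g₀, mu, hmu, hmod, hg₀⟩ := exists_SU_distinct n
    have h1 := h g₀
    rw [centralizerDim_eq hP hlam hg,
      centralizerDim_eq (P := 1) (one_mem _) hmod (by simpa using hg₀),
      (ker_offDiag_eq_bot_iff hmod).2 hmu, finrank_bot] at h1
    exact Submodule.finrank_eq_zero.1 (by omega)
  · intro h g'
    obtain ⟨Q, hQ, mu, hmod, hg'⟩ := exists_unitary_diagonalization
      (Matrix.mem_specialUnitaryGroup_iff.1 g'.2).1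
    rw [centralizerDim_eq hP hlam hg, centralizerDim_eq hQ hmod hg', h, finrank_bot]
    omega

theorem roots_prod_univ_X_sub_C {ι : Type*} [Fintype ι] (mu : ι → ℂ) :
    (∏ j, (Polynomial.X - Polynomial.C (mu j))).roots = Finset.univ.val.map mu := by
  rw [← Polynomial.roots_multiset_prod_X_sub_C (Finset.univ.val.map mu), Multiset.map_map]
  rfl

/-- A regular element is diagonalised by a unitary matrix with its eigenvalues, which are distinct,
in any prescribed order. -/
theorem IsRegular.exists_diagonalization {n : ℕ} {g : SU (n + 1)} (hreg : IsRegular g)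
    {mu : Fin (n + 1) → ℂ} (hmu : (g : Matrix (Fin (n + 1)) (Fin (n + 1)) ℂ).charpoly =
      ∏ j, (Polynomial.X - Polynomial.C (mu j))) :
    Function.Injective mu ∧ (∀ i, mu i * star (mu i) = 1) ∧
    ∃ P ∈ Matrix.unitaryGroup (Fin (n + 1)) ℂ,
      (g : Matrix (Fin (n + 1)) (Fin (n + 1)) ℂ) = P * Matrix.diagonal mu * star P := by
  obtain ⟨P, hP, lam, hlam, hg⟩ := exists_unitary_diagonalization
      (Matrix.mem_specialUnitaryGroup_iff.1 g.2).1
  have hinj := (isRegular_iff_injective hP hlam hg).1 hreg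
  have hroots : Finset.univ.val.map mu = Finset.univ.val.map lam := by
    rw [← roots_prod_univ_X_sub_C, ← roots_prod_univ_X_sub_C, ← hmu, hg,
      charpoly_conj_diagonal hP]
  have hmuinj : Function.Injective mu := by
    have h1 : (Finset.univ.val.map mu).Nodup := by
      rw [hroots]
      exact Finset.univ.nodup.map hinj
    intro i j hij
    exact Multiset.inj_on_of_nodup_map h1 i (Finset.mem_univ_val _) j (Finset.mem_univ_val _) hij
  have hex : ∀ j, ∃ i, lam i = mu j := by
    intro j
    have h1 : mu j ∈ Finset.univ.val.map lam := by
      rw [← hroots]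
      exact Multiset.mem_map_of_mem _ (Finset.mem_univ_val _)
    obtain ⟨i, -, hi⟩ := Multiset.mem_map.1 h1
    exact ⟨i, hi⟩
  choose σ hσ using hex
  have hσinj : Function.Injective σ := fun i j hij => hmuinj (by rw [← hσ, ← hσ, hij])
  let e : Equiv.Perm (Fin (n + 1)) := Equiv.ofBijective σ (Finite.injective_iff_bijective.1 hσinj)
  have he : ∀ j, lam (e j) = mu j := hσ
  refine ⟨hmuinj, fun i => by rw [← hσ, hlam], P.submatrix id e, ?_, ?_⟩
  · rw [Matrix.mem_unitaryGroup_iff']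
    show (star P * P).submatrix e e = 1
    rw [Matrix.mem_unitaryGroup_iff'.1 hP]
    exact Matrix.submatrix_one_equiv e
  · rw [hg]
    ext i j
    rw [Matrix.mul_apply, Matrix.mul_apply, ← Equiv.sum_comp e]
    refine Finset.sum_congr rfl fun k _ => ?_
    rw [Matrix.mul_diagonal, Matrix.mul_diagonal, he]
    rfl

/-! ### Local existence of angles -/

/-- The characteristic polynomial of `ρ t`, as a function of the class `[ρ]`. -/
noncomputable def classCharpoly {N : ℕ} : RegClasses N → Polynomial ℂ :=
  Quotient.lift (fun ρ : RegRep N => (ρ.1 gen : Matrix (Fin N) (Fin N) ℂ).charpoly) (by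
    rintro ρ ρ' ⟨g, hg⟩
    show (ρ.1 gen : Matrix (Fin N) (Fin N) ℂ).charpoly =
      (ρ'.1 gen : Matrix (Fin N) (Fin N) ℂ).charpoly
    rw [hg gen]
    show _ = ((g : Matrix (Fin N) (Fin N) ℂ) * (ρ.1 gen : Matrix (Fin N) (Fin N) ℂ) *
      star (g : Matrix (Fin N) (Fin N) ℂ)).charpoly
    rw [Matrix.charpoly_mul_comm, ← Matrix.mul_assoc, SU.star_mul_self, Matrix.one_mul])

theorem classCharpoly_mk {N : ℕ} (ρ : RegRep N) :
    classCharpoly ⟦ρ⟧ = (ρ.1 gen : Matrix (Fin N) (Fin N) ℂ).charpoly := rfl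

theorem continuous_gen_matrix (N : ℕ) :
    Continuous fun ρ : RegRep N => (ρ.1 gen : Matrix (Fin N) (Fin N) ℂ) :=
  continuous_subtype_val.comp continuous_induced_dom

theorem continuous_eval_classCharpoly {N : ℕ} (z : ℂ) :
    Continuous fun c : RegClasses N => (classCharpoly c).eval z := by
  refine continuous_coinduced_dom.2 ?_
  show Continuous fun ρ : RegRep N => (ρ.1 gen : Matrix (Fin N) (Fin N) ℂ).charpoly.eval z
  simp only [Matrix.eval_charpoly]
  exact (continuous_const.sub (continuous_gen_matrix N)).matrix_det

theorem exists_classCharpoly_eq_prod {n : ℕ} (c : RegClasses (n + 1)) :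
    ∃ mu : Fin (n + 1) → ℂ, Function.Injective mu ∧ (∀ i, ‖mu i‖ = 1) ∧
      classCharpoly c = ∏ j, (Polynomial.X - Polynomial.C (mu j)) := by
  obtain ⟨ρ, rfl⟩ := Quotient.exists_rep c
  obtain ⟨P, hP, lam, hlam, hg⟩ := exists_unitary_diagonalization
    (Matrix.mem_specialUnitaryGroup_iff.1 (ρ.1 gen).2).1
  refine ⟨lam, (isRegular_iff_injective hP hlam hg).1 ρ.2, fun i => ?_, ?_⟩
  · have h := congrArg norm (hlam i)
    rw [norm_mul, norm_star, norm_one] at h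
    nlinarith [norm_nonneg (lam i)]
  · rw [classCharpoly_mk, hg, charpoly_conj_diagonal hP]

/-- If a monic polynomial is small at `z`, one of its roots is close to `z`. -/
theorem exists_root_near {n : ℕ} {mu : Fin n → ℂ} {z : ℂ} {δ : ℝ} (hδ : 0 < δ)
    (h : ‖(∏ j, (Polynomial.X - Polynomial.C (mu j))).eval z‖ < δ ^ n) :
    ∃ k, ‖z - mu k‖ < δ := by
  by_contra! hk
  rw [Polynomial.eval_prod, norm_prod] at h
  have h1 : ∏ _k : Fin n, δ ≤ ∏ k, ‖(Polynomial.X - Polynomial.C (mu k)).eval z‖ := by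
    refine Finset.prod_le_prod (fun _ _ => hδ.le) fun k _ => ?_
    simpa using hk k
  rw [Finset.prod_const, Finset.card_univ, Fintype.card_fin] at h1
  exact absurd h h1.not_gt

/-- Around a class with eigenvalues `λ_j`, take the classes whose characteristic polynomial is small
at each `λ_j`. They have exactly one eigenvalue `μ_j` in each of `n + 1` disjoint discs around the
`λ_j`; it depends continuously on the class, and its angle is a branch of the argument near
`λ_j`. -/
theorem exists_isAngleSystem {n : ℕ} (ρ : RegRep (n + 1)) :
    ∃ (U : Set (RegClasses (n + 1))) (θ : Fin (n + 1) → RegClasses (n + 1) → ℝ),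
      IsAngleSystem U θ ∧ ⟦ρ⟧ ∈ U := by
  obtain ⟨lam, hinj, hlam, hchar⟩ := exists_classCharpoly_eq_prod ⟦ρ⟧
  have hlam0 : ∀ j, lam j ≠ 0 := fun j h => by simpa [h] using hlam j
  -- the discs of radius `δ` around the eigenvalues are disjoint, and do not reach `0`
  obtain ⟨δ, hδ0, hδ1, hδ⟩ : ∃ δ : ℝ, 0 < δ ∧ δ < 1 ∧
      ∀ i j, i ≠ j → δ + δ < ‖lam i - lam j‖ := by
    have h1 : ∀ᶠ δ : ℝ in 𝓝[>] 0, ∀ i j, i ≠ j → δ + δ < ‖lam i - lam j‖ := by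
      refine eventually_all.2 fun i => eventually_all.2 fun j => eventually_imp_distrib_left.2 ?_
      intro hij
      have h2 : Tendsto (fun δ : ℝ => δ + δ) (𝓝[>] 0) (𝓝 (0 + 0)) :=
        ((continuous_id.add continuous_id).tendsto 0).mono_left nhdsWithin_le_nhds
      refine h2.eventually_lt_const ?_
      rw [add_zero]
      exact norm_pos_iff.2 (sub_ne_zero.2 (hinj.ne hij))
    have h3 : ∀ᶠ δ : ℝ in 𝓝[>] 0, δ < 1 :=
      (eventually_lt_nhds one_pos).filter_mono nhdsWithin_le_nhds
    obtain ⟨δ, h4, h5, h6⟩ := (h1.and (h3.and self_mem_nhdsWithin)).exists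
    exact ⟨δ, h6, h5, h4⟩
  have hdisj : ∀ {i j : Fin (n + 1)} {z : ℂ}, ‖lam i - z‖ < δ → ‖lam j - z‖ < δ → i = j := by
    intro i j z hi hj
    by_contra hij
    have h1 : ‖lam i - lam j‖ ≤ ‖lam i - z‖ + ‖lam j - z‖ := by
      rw [← norm_neg (lam j - z), show lam i - lam j = (lam i - z) + -(lam j - z) by ring]
      exact norm_add_le _ _
    linarith [hδ i j hij]
  set U : Set (RegClasses (n + 1)) :=
    {c | ∀ j, ‖(classCharpoly c).eval (lam j)‖ < δ ^ (n + 1)} with hU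
  have hUo : IsOpen U := by
    rw [hU, Set.ofPred_forall]
    exact isOpen_iInter_of_finite fun j =>
      isOpen_lt (continuous_eval_classCharpoly _).norm continuous_const
  have hex : ∀ c ∈ U, ∃ mu : Fin (n + 1) → ℂ, (∀ j, ‖lam j - mu j‖ < δ) ∧ (∀ j, ‖mu j‖ = 1) ∧
      classCharpoly c = ∏ j, (Polynomial.X - Polynomial.C (mu j)) := by
    intro c hc
    obtain ⟨mu, -, hmu, hcmu⟩ := exists_classCharpoly_eq_prod c
    have hk : ∀ j, ∃ k, ‖lam j - mu k‖ < δ := by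
      intro j
      have h1 := hc j
      rw [hcmu] at h1
      exact exists_root_near hδ0 h1
    choose k hk using hk
    have hkinj : Function.Injective k := fun i j hij => hdisj (hk i) (hij ▸ hk j)
    let e : Equiv.Perm (Fin (n + 1)) := Equiv.ofBijective k (Finite.injective_iff_bijective.1 hkinj)
    refine ⟨fun j => mu (e j), hk, fun j => hmu _, ?_⟩
    rw [hcmu]
    exact (Equiv.prod_comp e fun j => Polynomial.X - Polynomial.C (mu j)).symm
  choose! mu hnear hnorm hprod using hex
  have hcont : ∀ j, ContinuousOn (fun c => mu c j) U := by
    intro j c hc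
    refine ContinuousAt.continuousWithinAt ?_
    rw [Metric.continuousAt_iff']
    intro ε hε
    -- an eigenvalue this close to `μ_j` stays in the `j`-th disc
    set η := min ε (δ - ‖lam j - mu c j‖) with hη
    have hη0 : 0 < η := lt_min hε (sub_pos.2 (hnear c hc j))
    have hroot : (classCharpoly c).eval (mu c j) = 0 := by
      rw [hprod c hc, Polynomial.eval_prod]
      exact Finset.prod_eq_zero (Finset.mem_univ j) (by simp)
    have h1 : ∀ᶠ c' in 𝓝 c, ‖(classCharpoly c').eval (mu c j)‖ < η ^ (n + 1) := by
      refine (continuous_eval_classCharpoly (mu c j)).norm.continuousAt.eventually_lt_const ?_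
      show ‖(classCharpoly c).eval (mu c j)‖ < _
      rw [hroot, norm_zero]
      positivity
    filter_upwards [h1, hUo.mem_nhds hc] with c' h2 hc'
    rw [hprod c' hc'] at h2
    obtain ⟨k, hk⟩ := exists_root_near hη0 h2
    have h3 : ‖lam j - mu c' k‖ < δ := by
      have h4 : ‖lam j - mu c' k‖ ≤ ‖lam j - mu c j‖ + ‖mu c j - mu c' k‖ := by
        rw [show lam j - mu c' k = (lam j - mu c j) + (mu c j - mu c' k) by ring]
        exact norm_add_le _ _
      have h5 : η ≤ δ - ‖lam j - mu c j‖ := min_le_right _ _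
      linarith
    have hkj : j = k := hdisj h3 (hnear c' hc' k)
    subst hkj
    rw [dist_comm, dist_eq_norm]
    exact hk.trans_le (min_le_left _ _)
  have hslit : ∀ c ∈ U, ∀ j, mu c j / lam j ∈ Complex.slitPlane := by
    intro c hc j
    have h1 : ‖mu c j / lam j - 1‖ < 1 := by
      rw [div_sub_one (hlam0 j), norm_div, hlam, div_one, norm_sub_rev]
      exact (hnear c hc j).trans hδ1
    have h2 := Complex.mem_slitPlane_of_norm_lt_one h1
    rwa [add_sub_cancel] at h2
  have hexp : ∀ z : ℂ, ‖z‖ = 1 → Complex.exp (Complex.I * (Complex.arg z : ℂ)) = z := by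
    intro z hz
    have := Complex.norm_mul_exp_arg_mul_I z
    rwa [hz, Complex.ofReal_one, one_mul, mul_comm] at this
  refine ⟨U, fun j c => Complex.arg (lam j) + Complex.arg (mu c j / lam j),
    ⟨hUo, fun j => ?_, fun ρ' hρ' => ?_⟩, fun j => ?_⟩
  · refine continuousOn_const.add fun c hc => ?_
    exact ContinuousAt.comp_continuousWithinAt (f := fun c => mu c j / lam j)
      (Complex.continuousAt_arg (hslit c hc j)) ((hcont j).div_const _ c hc)
  · rw [← classCharpoly_mk, hprod _ hρ']
    refine Finset.prod_congr rfl fun j _ => ?_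
    rw [Complex.ofReal_add, mul_add, Complex.exp_add, hexp _ (hlam j), hexp,
      mul_div_cancel₀ _ (hlam0 j)]
    rw [norm_div, hlam, hnorm _ hρ', div_one]
  · rw [hchar, Polynomial.eval_prod, Finset.prod_eq_zero (Finset.mem_univ j) (by simp), norm_zero]
    positivity

/-! ### First-order perturbation of the eigenvalues -/

/-- A product of a differentiable function vanishing at `0` and a merely continuous one is
differentiable at `0`. -/
theorem hasDerivAt_mul_of_eq_zero {q h f : ℝ → ℂ} {q' : ℂ} (hq : HasDerivAt q q' 0) (hq0 : q 0 = 0)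
    (hh : ContinuousAt h 0) (hf : ∀ᶠ s in 𝓝 0, f s = q s * h s) : HasDerivAt f (q' * h 0) 0 := by
  have hf' : f =ᶠ[𝓝 0] fun s => q s * h s := hf
  refine HasDerivAt.congr_of_eventuallyEq ?_ hf'
  rw [hasDerivAt_iff_tendsto_slope]
  refine ((hq.tendsto_slope).mul (hh.tendsto.mono_left nhdsWithin_le_nhds)).congr fun s => ?_
  simp only [slope_def_module, hq0, zero_mul, sub_zero, smul_mul_assoc]

theorem hasDerivAt_mul_mul {m : Type*} [Fintype m] (A B : Matrix m m ℂ) {M : ℝ → Matrix m m ℂ}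
    {M' : Matrix m m ℂ} (hM : ∀ i j, HasDerivAt (fun s => M s i j) (M' i j) 0) (i j : m) :
    HasDerivAt (fun s => (A * M s * B) i j) ((A * M' * B) i j) 0 := by
  simp only [Matrix.mul_apply]
  exact HasDerivAt.fun_sum fun k _ => (HasDerivAt.fun_sum fun l _ =>
    (hM l k).const_mul (A i l)).mul_const (B k j)

/-- The derivative of the determinant at a diagonal matrix with a zero on the diagonal, from
the expansion along the row that vanishes. -/
theorem hasDerivAt_det_of_eq_diagonal {m : Type*} [Fintype m] [DecidableEq m]
    {M : ℝ → Matrix m m ℂ} {M' : Matrix m m ℂ}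
    (hM : ∀ i j, HasDerivAt (fun s => M s i j) (M' i j) 0) {d : m → ℂ}
    (h0 : M 0 = Matrix.diagonal d) {j : m} (hd : d j = 0) :
    HasDerivAt (fun s => (M s).det) (M' j j * ∏ k ∈ Finset.univ.erase j, d k) 0 := by
  have hcont : ContinuousAt M 0 :=
    continuousAt_pi.2 fun i => continuousAt_pi.2 fun k => (hM i k).continuousAt
  have hadj : ∀ k, ContinuousAt (fun s => (M s).adjugate k j) 0 := by
    intro k
    have h1 : Continuous fun A : Matrix m m ℂ => A.adjugate k j :=
      (continuous_id.matrix_adjugate).matrix_elem k j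
    exact h1.continuousAt.comp hcont
  have h1 : HasDerivAt (fun s => (M s).det) (∑ k, M' j k * (M 0).adjugate k j) 0 := by
    simp only [Matrix.det_eq_sum_mul_adjugate_row _ j]
    refine HasDerivAt.fun_sum fun k _ => ?_
    refine hasDerivAt_mul_of_eq_zero (hM j k) ?_ (hadj k) (Eventually.of_forall fun s => rfl)
    rw [h0]
    by_cases hjk : j = k
    · rw [← hjk, Matrix.diagonal_apply_eq, hd]
    · rw [Matrix.diagonal_apply_ne _ hjk]
  convert! h1 using 1
  rw [h0, Matrix.adjugate_diagonal, Finset.sum_eq_single j, Matrix.diagonal_apply_eq]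
  · intro k _ hk
    rw [Matrix.diagonal_apply_ne _ hk, mul_zero]
  · simp

/-- A continuous logarithm of a differentiable curve on the circle is differentiable. -/
theorem hasDerivAt_of_exp {θ : ℝ → ℝ} (hθ : ContinuousAt θ 0) {y : ℂ}
    (h : HasDerivAt (fun s => Complex.exp (Complex.I * θ s))
      (Complex.exp (Complex.I * θ 0) * y) 0) :
    HasDerivAt θ y.im 0 := by
  have hne : Complex.exp (Complex.I * θ 0) ≠ 0 := Complex.exp_ne_zero _
  have h1 := h.div_const (Complex.exp (Complex.I * θ 0))
  rw [mul_div_cancel_left₀ _ hne] at h1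
  have h2 := h1.clog_real (by rw [div_self hne]; exact Complex.one_mem_slitPlane)
  rw [div_self hne, div_one] at h2
  have h3 : HasDerivAt (fun s => θ 0 + (Complex.log (Complex.exp (Complex.I * θ s) /
      Complex.exp (Complex.I * θ 0))).im) y.im 0 :=
    (Complex.imCLM.hasFDerivAt.comp_hasDerivAt 0 h2).const_add (θ 0)
  refine h3.congr_of_eventuallyEq ?_
  have hev : ∀ᶠ s in 𝓝 0, |θ s - θ 0| < Real.pi := by
    have h4 : ContinuousAt (fun s => |θ s - θ 0|) 0 := (hθ.sub continuousAt_const).abs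
    refine h4.eventually_lt_const ?_
    simpa using Real.pi_pos
  filter_upwards [hev] with s hs
  have h5 := abs_lt.1 hs
  rw [← Complex.exp_sub, Complex.log_exp]
  · simp
  · simpa using h5.1
  · simpa using h5.2.le

/-- A curve of representations with differentiable matrix entries is continuous in the space of
representations. -/
theorem continuousAt_curve {N : ℕ} {c : ℝ → RegRep N} {M' : Matrix (Fin N) (Fin N) ℂ}
    (hc : ∀ i j, HasDerivAt (fun s => ((c s).1 gen : Matrix (Fin N) (Fin N) ℂ) i j) (M' i j) 0) :
    ContinuousAt c 0 := by
  have h : ContinuousAt (fun s => ((c s).1 gen : Matrix (Fin N) (Fin N) ℂ)) 0 :=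
    continuousAt_pi.2 fun i => continuousAt_pi.2 fun k => (hc i k).continuousAt
  have hind : IsInducing fun ρ : RegRep N => (ρ.1 gen : Matrix (Fin N) (Fin N) ℂ) :=
    IsInducing.subtypeVal.comp ⟨rfl⟩
  exact hind.continuousAt_iff.2 h

theorem IsAngleSystem.classCharpoly_eq {N : ℕ} {U : Set (RegClasses N)}
    {θ : Fin N → RegClasses N → ℝ} (hθ : IsAngleSystem U θ) {c : RegClasses N} (hc : c ∈ U) :
    classCharpoly c =
      ∏ j, (Polynomial.X - Polynomial.C (Complex.exp (Complex.I * (θ j c : ℂ)))) := by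
  obtain ⟨ρ, rfl⟩ := Quotient.exists_rep c
  exact hθ.charpoly_eq ρ hc

/-- First-order perturbation theory: along a curve through `ρ` with velocity `X`, the angle `θ_j`
moves with the velocity `Im (P⁻¹ X P)_jj`. -/
theorem IsAngleSystem.hasDerivAt {n : ℕ} {U : Set (RegClasses (n + 1))}
    {θ : Fin (n + 1) → RegClasses (n + 1) → ℝ} (hθ : IsAngleSystem U θ) {ρ : RegRep (n + 1)}
    (hρ : ⟦ρ⟧ ∈ U) {P : Matrix (Fin (n + 1)) (Fin (n + 1)) ℂ}
    (hP : P ∈ Matrix.unitaryGroup (Fin (n + 1)) ℂ)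
    (hinj : Function.Injective fun j => Complex.exp (Complex.I * (θ j ⟦ρ⟧ : ℂ)))
    (hg : (ρ.1 gen : Matrix (Fin (n + 1)) (Fin (n + 1)) ℂ) =
      P * Matrix.diagonal (fun j => Complex.exp (Complex.I * (θ j ⟦ρ⟧ : ℂ))) * star P)
    {c : ℝ → RegRep (n + 1)} {X : su (n + 1)} (hc0 : c 0 = ρ)
    (hc : ∀ i j, HasDerivAt (fun s => ((c s).1 gen : Matrix (Fin (n + 1)) (Fin (n + 1)) ℂ) i j)
      ((X.1 * (ρ.1 gen : Matrix (Fin (n + 1)) (Fin (n + 1)) ℂ)) i j) 0) (j : Fin (n + 1)) :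
    HasDerivAt (fun s => θ j ⟦c s⟧) ((suConj P hP X).1 j j).im 0 := by
  have hcont : ContinuousAt (fun s => (⟦c s⟧ : RegClasses (n + 1))) 0 :=
    (continuous_quotient_mk'.continuousAt (x := c 0)).comp (continuousAt_curve hc)
  have hU : ∀ᶠ s in 𝓝 0, (⟦c s⟧ : RegClasses (n + 1)) ∈ U :=
    hcont.eventually_mem (hθ.isOpen.mem_nhds (by rw [hc0]; exact hρ))
  have hθc : ∀ k, ContinuousAt (fun s => θ k ⟦c s⟧) 0 := by
    intro k
    have h1 : ContinuousAt (θ k) (⟦c 0⟧ : RegClasses (n + 1)) := by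
      rw [hc0]
      exact (hθ.continuousOn k).continuousAt (hθ.isOpen.mem_nhds hρ)
    exact ContinuousAt.comp (f := fun s => (⟦c s⟧ : RegClasses (n + 1))) h1 hcont
  set mu : Fin (n + 1) → ℝ → ℂ := fun k s => Complex.exp (Complex.I * (θ k ⟦c s⟧ : ℂ)) with hmu
  have hmuc : ∀ k, ContinuousAt (mu k) 0 := fun k =>
    (continuousAt_const.mul (Complex.continuous_ofReal.continuousAt.comp (hθc k))).cexp
  have hmu0 : ∀ k, mu k 0 = Complex.exp (Complex.I * (θ k ⟦ρ⟧ : ℂ)) := fun k => by rw [hmu, ← hc0]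
  set G : ℝ → Matrix (Fin (n + 1)) (Fin (n + 1)) ℂ := fun s => (c s).1 gen with hG
  set z := mu j 0 with hz
  set R : ℝ → ℂ := fun s => ∏ k ∈ Finset.univ.erase j, (z - mu k s) with hR
  have hRc : ContinuousAt R 0 := by
    refine tendsto_finsetProd _ fun k _ => ?_
    exact continuousAt_const.sub (hmuc k)
  have hR0 : R 0 ≠ 0 := by
    refine Finset.prod_ne_zero_iff.2 fun k hk => ?_
    rw [hz, hmu0, hmu0]
    exact sub_ne_zero.2 (hinj.ne (Finset.ne_of_mem_erase hk).symm)
  -- the characteristic polynomial at the eigenvalue `z` of `ρ t`, conjugated to diagonal form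
  have hdet : ∀ᶠ s in 𝓝 0, (star P * (z • 1 - G s) * P).det = (z - mu j s) * R s := by
    filter_upwards [hU] with s hs
    have h1 := congrArg (Polynomial.eval z) (hθ.classCharpoly_eq hs)
    rw [classCharpoly_mk, Matrix.eval_charpoly, Matrix.scalar_apply, ← Matrix.smul_one_eq_diagonal,
      Polynomial.eval_prod, ← Finset.mul_prod_erase _ _ (Finset.mem_univ j)] at h1
    simp only [Polynomial.eval_sub, Polynomial.eval_X, Polynomial.eval_C] at h1
    rw [Matrix.det_mul_right_comm, Matrix.mem_unitaryGroup_iff'.1 hP, Matrix.one_mul]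
    exact h1
  have hDz : star P * (z • 1 - G 0) * P = Matrix.diagonal fun k => z - mu k 0 := by
    have e1 : G 0 = P * Matrix.diagonal (fun k => mu k 0) * star P := by
      simp only [hmu0]
      rw [← hg, ← hc0]
    rw [e1, Matrix.mul_sub, Matrix.sub_mul, Matrix.mul_smul, Matrix.mul_one, Matrix.smul_mul,
      Matrix.mem_unitaryGroup_iff'.1 hP]
    rw [show star P * (P * Matrix.diagonal (fun k => mu k 0) * star P) * P =
      (star P * P) * Matrix.diagonal (fun k => mu k 0) * (star P * P) by
        simp only [Matrix.mul_assoc], Matrix.mem_unitaryGroup_iff'.1 hP, Matrix.one_mul,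
      Matrix.mul_one, Matrix.smul_one_eq_diagonal, Matrix.diagonal_sub]
  have hM' : ∀ i k, HasDerivAt (fun s => (z • (1 : Matrix (Fin (n + 1)) (Fin (n + 1)) ℂ) - G s) i k)
      ((-(X.1 * (ρ.1 gen : Matrix (Fin (n + 1)) (Fin (n + 1)) ℂ))) i k) 0 := by
    intro i k
    exact (hc i k).const_sub _
  have hq := hasDerivAt_det_of_eq_diagonal (j := j)
    (fun i k => hasDerivAt_mul_mul (star P) P hM' i k) hDz (by simp [hz])
  have hval : (star P * -(X.1 * (ρ.1 gen : Matrix (Fin (n + 1)) (Fin (n + 1)) ℂ)) * P) j j =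
      -((suConj P hP X).1 j j * z) := by
    have e1 : star P * -(X.1 * (ρ.1 gen : Matrix (Fin (n + 1)) (Fin (n + 1)) ℂ)) * P =
        -((suConj P hP X).1 *
          Matrix.diagonal (fun j => Complex.exp (Complex.I * (θ j ⟦ρ⟧ : ℂ)))) := by
      show _ = -((star P * X.1 * P) * _)
      rw [hg, Matrix.mul_neg, Matrix.neg_mul]
      congr 1
      calc _ = (star P * X.1 * P) * Matrix.diagonal
            (fun j => Complex.exp (Complex.I * (θ j ⟦ρ⟧ : ℂ))) * (star P * P) := by
              simp only [Matrix.mul_assoc]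
        _ = _ := by rw [Matrix.mem_unitaryGroup_iff'.1 hP, Matrix.mul_one]
    rw [e1, Matrix.neg_apply, Matrix.mul_diagonal, hz, hmu0]
  rw [hval] at hq
  -- dividing by the other factors of the characteristic polynomial isolates `z - μ_j`
  have hmain : HasDerivAt (fun s => z - mu j s)
      (-((suConj P hP X).1 j j * z) * R 0 * (R 0)⁻¹) 0 := by
    refine hasDerivAt_mul_of_eq_zero (h := fun s => (R s)⁻¹) hq ?_ (hRc.inv₀ hR0) ?_
    · rw [hdet.self_of_nhds, hz, sub_self, zero_mul]
    · filter_upwards [hdet, hRc.eventually_ne hR0] with s hs hs'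
      rw [hs, mul_assoc, mul_inv_cancel₀ hs', mul_one]
  rw [mul_assoc, mul_inv_cancel₀ hR0, mul_one] at hmain
  refine hasDerivAt_of_exp (hθc j) ?_
  have h2 := hmain.const_sub z
  simp only [sub_sub_cancel, neg_neg] at h2
  rw [mul_comm] at h2
  exact h2

/-! ### Differentials of the angles -/

theorem classOf_sub_eq_zero {V : Type*} [AddCommGroup V] [Module ℝ V]
    (φ : Representation ℝ CircleGroup V) (w : V) : classOf φ (φ gen w - w) = 0 := by
  have h : (evalEquiv φ).symm (φ gen w - w) = coboundary φ ((evalEquiv φ).symm w) := by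
    rw [LinearEquiv.symm_apply_eq, coboundary_apply_zero, LinearEquiv.apply_symm_apply]
  show (LinearMap.range (coboundary φ)).mkQ ((evalEquiv φ).symm (φ gen w - w)) = 0
  rw [h, Submodule.mkQ_apply, Submodule.Quotient.mk_eq_zero]
  exact LinearMap.mem_range_self _ _

/-- Linear forms on `V` that vanish on the values `φ t w - w` of coboundaries descend to `H¹`. -/
theorem exists_dual_classOf {V : Type*} [AddCommGroup V] [Module ℝ V]
    (φ : Representation ℝ CircleGroup V) (f : V →ₗ[ℝ] ℝ) (hf : ∀ w, f (φ gen w - w) = 0) :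
    ∃ L : Module.Dual ℝ (H1 φ), ∀ x, L (classOf φ x) = f x := by
  refine ⟨(LinearMap.range (coboundary φ)).liftQ (f ∘ₗ (evalEquiv φ).toLinearMap) ?_, fun x => ?_⟩
  · rintro _ ⟨w, rfl⟩
    rw [LinearMap.mem_ker]
    show f (evalEquiv φ (coboundary φ w)) = 0
    rw [coboundary_apply_zero, hf]
  · show f (evalEquiv φ ((evalEquiv φ).symm x)) = _
    rw [LinearEquiv.apply_symm_apply]

/-- The linear forms `X ↦ Im (P⁻¹ X P)_jj` vanish on coboundaries. -/
theorem exists_dual_classOf_eq {N : ℕ} {P : Matrix (Fin N) (Fin N) ℂ}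
    (hP : P ∈ Matrix.unitaryGroup (Fin N) ℂ) {lam : Fin N → ℂ}
    (hlam : ∀ i, lam i * star (lam i) = 1) {ρ : RegRep N}
    (hg : (ρ.1 gen : Matrix (Fin N) (Fin N) ℂ) = P * Matrix.diagonal lam * star P) (j : Fin N) :
    ∃ L : Module.Dual ℝ (H1 (AdRep ρ)),
      ∀ X, L (classOf (AdRep ρ) X) = ((suConj P hP X).1 j j).im := by
  let f : su N →ₗ[ℝ] ℝ :=
    { toFun := fun X => ((suConj P hP X).1 j j).im
      map_add' := fun X Y => by simp
      map_smul' := fun c X => by simp }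
  refine exists_dual_classOf (AdRep ρ) f fun w => ?_
  show ((suConj P hP (Ad N (ρ.1 gen) w - w)).1 j j).im = 0
  rw [suConj_Ad_sub_apply hP hg, hlam, sub_self, zero_mul, Complex.zero_im]

theorem diagonal_mem_su {N : ℕ} {y : Fin N → ℝ} (hy : ∑ k, y k = 0) :
    Matrix.diagonal (fun k => Complex.I * (y k : ℂ)) ∈ su N := by
  constructor
  · rw [Matrix.diagonal_conjTranspose, Matrix.diagonal_neg]
    congr 1
    funext k
    simp
  · rw [Matrix.trace_diagonal, ← Finset.mul_sum, ← Complex.ofReal_sum, hy]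
    simp

/-- Modulo coboundaries, every tangent vector is diagonal in the eigenbasis of `ρ t`. -/
theorem classOf_eq_classOf_diagonal {n : ℕ} {P : Matrix (Fin (n + 1)) (Fin (n + 1)) ℂ}
    (hP : P ∈ Matrix.unitaryGroup (Fin (n + 1)) ℂ) {lam : Fin (n + 1) → ℂ}
    (hlam : ∀ i, lam i * star (lam i) = 1) (hinj : Function.Injective lam) {ρ : RegRep (n + 1)}
    (hg : (ρ.1 gen : Matrix (Fin (n + 1)) (Fin (n + 1)) ℂ) = P * Matrix.diagonal lam * star P)
    (X : su (n + 1)) :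
    classOf (AdRep ρ) X = classOf (AdRep ρ)
      ((suConj P hP).symm ⟨_, diagonal_mem_su (su_sum_im (suConj P hP X))⟩) := by
  set X' := (suConj P hP).symm ⟨_, diagonal_mem_su (su_sum_im (suConj P hP X))⟩ with hX'
  have hsurj : Function.Surjective (offDiag lam) :=
    LinearMap.injective_iff_surjective.1
      (LinearMap.ker_eq_bot.1 ((ker_offDiag_eq_bot_iff hlam).2 hinj))
  obtain ⟨w, hw⟩ := hsurj (frameCoords P hP (X - X')).2
  have h1 : AdRep ρ gen ((frameCoords P hP).symm (0, w)) - (frameCoords P hP).symm (0, w) =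
      X - X' := by
    apply (frameCoords P hP).injective
    show frameCoords P hP (Ad (n + 1) (ρ.1 gen) _ - _) = _
    rw [frameCoords_Ad hP hlam hg, LinearEquiv.apply_symm_apply, hw]
    refine Prod.ext ?_ rfl
    funext i
    show 0 = ((suConj P hP (X - X')).1 i.castSucc i.castSucc).im
    rw [map_sub, hX', LinearEquiv.apply_symm_apply]
    simp
  rw [← sub_eq_zero, ← map_sub, ← h1, classOf_sub_eq_zero]

/-- Rotating the eigenvalues of `ρ t` along its eigenlines gives a curve of regular
representations with diagonal velocity. -/
theorem exists_curve_diagonal {n : ℕ} {P : Matrix (Fin (n + 1)) (Fin (n + 1)) ℂ}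
    (hP : P ∈ Matrix.unitaryGroup (Fin (n + 1)) ℂ) {lam : Fin (n + 1) → ℂ}
    (hlam : ∀ i, lam i * star (lam i) = 1) (hinj : Function.Injective lam) {ρ : RegRep (n + 1)}
    (hg : (ρ.1 gen : Matrix (Fin (n + 1)) (Fin (n + 1)) ℂ) = P * Matrix.diagonal lam * star P)
    {y : Fin (n + 1) → ℝ} (hy : ∑ k, y k = 0) :
    ∃ c : ℝ → RegRep (n + 1), c 0 = ρ ∧
      ∀ i j, HasDerivAt (fun s => ((c s).1 gen : Matrix (Fin (n + 1)) (Fin (n + 1)) ℂ) i j)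
        ((((suConj P hP).symm ⟨_, diagonal_mem_su hy⟩).1 *
          (ρ.1 gen : Matrix (Fin (n + 1)) (Fin (n + 1)) ℂ)) i j) 0 := by
  classical
  set d : ℝ → Fin (n + 1) → ℂ := fun s k => lam k * Complex.exp ((s * y k : ℝ) * Complex.I) with hd
  have hd0 : d 0 = lam := by
    funext k
    simp [hd]
  have hdmod : ∀ s k, d s k * star (d s k) = 1 := by
    intro s k
    have h1 : Complex.exp ((s * y k : ℝ) * Complex.I) *
        star (Complex.exp ((s * y k : ℝ) * Complex.I)) = 1 := by
      rw [Complex.star_def, Complex.mul_conj, Complex.normSq_eq_norm_sq,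
        Complex.norm_exp_ofReal_mul_I]
      simp
    rw [hd, star_mul']
    linear_combination h1 * (lam k * star (lam k)) + hlam k
  have hprod : ∀ s, ∏ k, d s k = 1 := by
    intro s
    have h1 : ∏ k, lam k = 1 := by
      have h2 := (Matrix.mem_specialUnitaryGroup_iff.1 (ρ.1 gen).2).2
      rwa [hg, Matrix.det_mul_right_comm, Matrix.mem_unitaryGroup_iff.1 hP, Matrix.one_mul,
        Matrix.det_diagonal] at h2
    rw [hd, Finset.prod_mul_distrib, h1, one_mul, ← Complex.exp_sum, ← Finset.sum_mul,
      ← Complex.ofReal_sum, ← Finset.mul_sum, hy]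
    simp
  have hmem : ∀ s, P * Matrix.diagonal (d s) * star P ∈
      Matrix.specialUnitaryGroup (Fin (n + 1)) ℂ := by
    intro s
    rw [Matrix.mem_specialUnitaryGroup_iff]
    constructor
    · refine mul_mem (mul_mem hP ?_) (Unitary.star_mem hP)
      rw [Matrix.mem_unitaryGroup_iff, Matrix.star_eq_conjTranspose, Matrix.diagonal_conjTranspose,
        Matrix.diagonal_mul_diagonal, ← Matrix.diagonal_one]
      congr 1
      funext k
      exact hdmod s k
    · rw [Matrix.det_mul_right_comm, Matrix.mem_unitaryGroup_iff.1 hP, Matrix.one_mul,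
        Matrix.det_diagonal, hprod]
  set g : ℝ → SU (n + 1) := fun s => ⟨_, hmem s⟩ with hgdef
  have hg0 : g 0 = ρ.1 gen := by
    apply Subtype.ext
    show P * Matrix.diagonal (d 0) * star P = _
    rw [hd0, hg]
  have hdder : ∀ k, HasDerivAt (fun s => d s k) (Complex.I * (y k : ℂ) * lam k) 0 := by
    intro k
    have h1 : HasDerivAt (fun s : ℝ => ((s * y k : ℝ) : ℂ)) ((1 * y k : ℝ) : ℂ) 0 :=
      ((hasDerivAt_id (0 : ℝ)).mul_const (y k)).ofReal_comp
    have h2 := ((h1.mul_const Complex.I).cexp).const_mul (lam k)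
    convert! h2 using 1
    simp
    ring
  have hreg : ∀ᶠ s in 𝓝 0, IsRegular (g s) := by
    have h1 : ∀ᶠ s in 𝓝 0, ∀ i j, i ≠ j → d s i - d s j ≠ 0 := by
      refine eventually_all.2 fun i => eventually_all.2 fun j => eventually_imp_distrib_left.2 ?_
      intro hij
      refine ((hdder i).continuousAt.sub (hdder j).continuousAt).eventually_ne ?_
      show d 0 i - d 0 j ≠ 0
      rw [hd0]
      exact sub_ne_zero.2 (hinj.ne hij)
    filter_upwards [h1] with s hs
    refine (isRegular_iff_injective hP (hdmod s) rfl).2 fun i j hij => ?_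
    by_contra hne
    exact hs i j hne (sub_eq_zero.2 hij)
  -- away from `s = 0` the rotated eigenvalues may collide; there the curve is constant
  refine ⟨fun s => if h : IsRegular (g s) then
    ⟨zpowersHom _ (g s), by simpa [gen] using h⟩ else ρ, ?_, fun i j => ?_⟩
  · have h1 : IsRegular (g 0) := hreg.self_of_nhds
    simp only [h1, dite_true]
    apply Subtype.ext
    refine MonoidHom.ext_mint ?_
    simpa [gen] using hg0
  · have hdiag : ∀ i j, HasDerivAt (fun s => Matrix.diagonal (d s) i j)
        (Matrix.diagonal (fun k => Complex.I * (y k : ℂ) * lam k) i j) 0 := by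
      intro i j
      by_cases hij : i = j
      · subst hij
        simpa using hdder i
      · simpa [Matrix.diagonal_apply_ne _ hij] using hasDerivAt_const (0 : ℝ) (0 : ℂ)
    have h1 := hasDerivAt_mul_mul P (star P) hdiag i j
    have hval : ((suConj P hP).symm ⟨_, diagonal_mem_su hy⟩).1 *
        (ρ.1 gen : Matrix (Fin (n + 1)) (Fin (n + 1)) ℂ) =
        P * Matrix.diagonal (fun k => Complex.I * (y k : ℂ) * lam k) * star P := by
      show P * Matrix.diagonal (fun k => Complex.I * (y k : ℂ)) * star P * _ = _
      have h2 : Matrix.diagonal (fun k => Complex.I * (y k : ℂ) * lam k) =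
          Matrix.diagonal (fun k => Complex.I * (y k : ℂ)) * Matrix.diagonal lam :=
        (Matrix.diagonal_mul_diagonal _ _).symm
      rw [hg, h2]
      calc _ = P * Matrix.diagonal (fun k => Complex.I * (y k : ℂ)) * (star P * P) *
            Matrix.diagonal lam * star P := by simp only [Matrix.mul_assoc]
        _ = _ := by
          rw [Matrix.mem_unitaryGroup_iff'.1 hP, Matrix.mul_one]
          simp only [Matrix.mul_assoc]
    rw [hval]
    refine h1.congr_of_eventuallyEq ?_
    filter_upwards [hreg] with s hs
    simp only [hs, dite_true]
    have h2 : zpowersHom (SU (n + 1)) (g s) gen = g s := by simp [gen]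
    rw [h2]

end PeripheralForm

theorem mainTheorem11 (N : ℕ) (hN : 1 ≤ N) :
    (∀ ρ : RegRep N, ∃ (U : Set (RegClasses N)) (θ : Fin N → RegClasses N → ℝ),
      IsAngleSystem U θ ∧ ⟦ρ⟧ ∈ U) ∧
    ∀ (U : Set (RegClasses N)) (θ : Fin N → RegClasses N → ℝ), IsAngleSystem U θ →
    ∀ ρ : RegRep N, ⟦ρ⟧ ∈ U →
      (∀ j, ∃ L, HasDifferentialAt (θ j) ρ L) ∧
      ∀ dθ : Fin N → Module.Dual ℝ (H1 (AdRep ρ)), (∀ j, HasDifferentialAt (θ j) ρ (dθ j)) →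
      ∀ ν : H1 (AdRep ρ) [⋀^Fin (N - 1)]→ₗ[ℝ] ℝ,
        IsPeripheralForm (AdRep ρ) (traceForm N) (traceForm_AdRep ρ) ν ↔
          ∃ s : ℤˣ, ν = (((s : ℤ) : ℝ) * ((2 : ℝ) ^ (N * (N - 1) / 2) * √(N : ℝ) *
            ∏ i, ∏ j ∈ Finset.Ioi i, Real.sin ((θ i ⟦ρ⟧ - θ j ⟦ρ⟧) / 2))) •
              wedge fun i : Fin (N - 1) => dθ (Fin.castLE (Nat.sub_le N 1) i) := by
  obtain ⟨n, rfl⟩ : ∃ n, N = n + 1 := ⟨N - 1, by omega⟩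
  refine ⟨exists_isAngleSystem, fun U θ hθ ρ hρ => ?_⟩
  obtain ⟨hinj, hlam, P, hP, hg⟩ := ρ.2.exists_diagonalization (hθ.charpoly_eq ρ hρ)
  choose L hL using fun j => exists_dual_classOf_eq hP hlam hg j
  refine ⟨fun j => ⟨L j, fun c X hc0 hc => ?_⟩, fun dθ hdθ ν => ?_⟩
  · rw [hL]
    exact hθ.hasDerivAt hρ hP hinj hg hc0 hc j
  have hdθL : ∀ j X, dθ j (classOf (AdRep ρ) X) = ((suConj P hP X).1 j j).im := by
    intro j X
    obtain ⟨c, hc0, hc⟩ := exists_curve_diagonal hP hlam hinj hg (su_sum_im (suConj P hP X))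
    rw [← hL, classOf_eq_classOf_diagonal hP hlam hinj hg X, hL]
    exact (hdθ j c _ hc0 hc).unique (hθ.hasDerivAt hρ hP hinj hg hc0 hc j)
  refine isPeripheralForm_iff (AdRep ρ) (traceForm (n + 1)) (traceForm_AdRep ρ)
    (even_finrank_upperPairs n) (frameCoords P hP) (offDiag _) ?_
    (frameCoords_Ad hP hlam hg) (gram n) ?_ _ ?_ _ (fun i X => hdθL _ X) ν
  · intro h
    exact LinearMap.det_eq_zero_iff_ker_ne_bot.1 h ((ker_offDiag_eq_bot_iff hlam).2 hinj)
  · intro X Y hY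
    rw [← traceForm_suConj P hP]
    exact traceForm_eq_gram _ _ hY
  · rw [det_offDiag_exp (fun i => θ i ⟦ρ⟧), det_gram]
    have h1 : √((n + 1 : ℕ) : ℝ) ^ 2 = n + 1 := by
      rw [Real.sq_sqrt (by positivity)]
      push_cast
      rfl
    rw [Nat.add_sub_cancel, mul_right_comm, mul_pow _ (√((n + 1 : ℕ) : ℝ)), h1]
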